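/- Let $H$ be a complex separable Hilbert space with an orthogonal splitting $H=H_1\oplus H_2$ into closed subspaces, with orthogonal projections $P_1,P_2$. For a bounded operator $A$ on $H$ put $A_{\mathrm{even}}=P_1AP_1+P_2AP_2$ and $A_{\mathrm{odd}}=P_1AP_2+P_2AP_1$. Let $\mathscr L_1(H)$ be the trace-class operators ($\|A\|_1=\operatorname{Tr}|A|<\infty$) and $\mathscr L_2(H)$ the Hilbert–Schmidt operators, with norm $\|\cdot\|_2$. Let $\mathscr L_{1|2}(H)$ be the set of bounded $A$ with $A_{\mathrm{even}}\in\mathscr L_1(H)$ and $A_{\mathrm{odd}}\in\mathscr L_2(H)$, with the topology given by $\|A_{\mathrm{even}}\|_1$ and $\|A_{\mathrm{odd}}\|_2$. For $A\in\mathscr L_1(H)$ let $\operatorname{Det}(1+A)=1+\sum_{n=1}^\infty\operatorname{Tr}(\wedge^n(A))$ be the classical Fredholm determinant, where $\wedge^n(A)$ is the operator induced by $A$ on the $n$-th antisymmetric tensor power of $H$. For $A\in\mathscr L_{1|2}(H)$ the extended Fredholm determinant is $$\operatorname{Det}(1+A)=\operatorname{Det}\big((1+A)e^{-A}\big)\cdot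 e^{\operatorname{Tr}(A_{\mathrm{even}})},$$ where the first factor on the right is a classical Fredholm determinant. For $n\ge1$ set $$C_n(A)=\frac1{n!}\sum_{\xi\in S_n}\operatorname{sign}(\xi)\prod_{\eta\in\operatorname{Cycle}(\xi)}t_{|\eta|}(A),\qquad t_1(A)=\operatorname{Tr}(A_{\mathrm{even}}),\quad t_k(A)=\operatorname{Tr}(A^k)\ (k\ge2),$$ where the product is over all cycles $\eta$ of $\xi$ (fixed points being cycles of length $1$) and $|\eta|$ is the length of $\eta$. Then the extended determinant agrees with the classical one on $\mathscr L_1(H)$ and is continuous on $\mathscr L_{1|2}(H)$; and for each $A\in\mathscr L_{1|2}(H)$ the series $\sum_{n\ge1} C_n(A)$ converges absolutely and $$\operatorname{Det}(1+A)=1+\sum_{n=1}^\infty C_n(A).$$ -/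

import Mathlib

noncomputable section

namespace ExtDet

section Operators

variable {H : Type*} [NormedAddCommGroup H] [InnerProductSpace ℂ H] [CompleteSpace H]

variable (H) in
/-- The index set of a fixed orthonormal basis of `H`. -/
def basisIndex : Set H := (exists_hilbertBasis ℂ H).choose

variable (H) in
/-- A fixed orthonormal basis of the Hilbert space `H` (traces and Hilbert-Schmidt norms do not
depend on its choice). -/
def stdBasis : HilbertBasis (basisIndex H) ℂ H := (exists_hilbertBasis ℂ H).choose_spec.choose

/-- The trace `Tr A = ∑ₙ (A eₙ, eₙ)`; Mathlib's inner product is linear in the second slot. -/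
def trace (A : H →L[ℂ] H) : ℂ := ∑' i, inner ℂ (stdBasis H i) (A (stdBasis H i))

/-- `A` is of trace class: `Tr |A| < ∞`, where `|A| = (A* A)^{1/2}` is `CFC.abs A`.
The terms of this series are nonnegative. -/
def IsTraceClass (A : H →L[ℂ] H) : Prop :=
  Summable fun i => (inner ℂ (stdBasis H i) (CFC.abs A (stdBasis H i))).re

/-- The trace norm `‖A‖₁ = Tr |A|` (of a trace class operator). -/
def traceNorm (A : H →L[ℂ] H) : ℝ :=
  ∑' i, (inner ℂ (stdBasis H i) (CFC.abs A (stdBasis H i))).re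

/-- `A` is a Hilbert-Schmidt operator: `∑ₙ ‖A eₙ‖² < ∞`. -/
def IsHilbertSchmidt (A : H →L[ℂ] H) : Prop :=
  Summable fun i => ‖A (stdBasis H i)‖ ^ 2

/-- The Hilbert-Schmidt norm `‖A‖₂` (of a Hilbert-Schmidt operator). -/
def hsNorm (A : H →L[ℂ] H) : ℝ := Real.sqrt (∑' i, ‖A (stdBasis H i)‖ ^ 2)

/-- The linear functional `⟨x₁ ∧ ⋯ ∧ xₙ, ·⟩` on the `n`-th exterior power of `H`, for the inner
product with `⟨x₁ ∧ ⋯ ∧ xₙ, y₁ ∧ ⋯ ∧ yₙ⟩ = det [⟨xᵢ, yⱼ⟩]`. -/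
def wedgeInner {n : ℕ} (x : Fin n → H) : Module.Dual ℂ (⋀[ℂ]^n H) :=
  exteriorPower.pairingDual ℂ H n (exteriorPower.ιMulti ℂ n fun j => innerₛₗ ℂ (x j))

open Classical in
/-- A linear order on the index set of the basis, used only to enumerate its finite subsets. -/
instance : LinearOrder (basisIndex H) := linearOrderOfSTO WellOrderingRel

/-- `Tr (∧ⁿ A)`: the trace of the operator induced by `A` on the `n`-th antisymmetric power,
computed in the orthonormal basis `e_{i₁} ∧ ⋯ ∧ e_{iₙ}`, `i₁ < ⋯ < iₙ`, of the latter. -/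
def traceWedge (n : ℕ) (A : H →L[ℂ] H) : ℂ :=
  ∑' i : Fin n ↪o basisIndex H,
    wedgeInner (fun j => stdBasis H (i j))
      (exteriorPower.map n (A : H →ₗ[ℂ] H) (exteriorPower.ιMulti ℂ n fun j => stdBasis H (i j)))

/-- The classical Fredholm determinant `Det (1 + A) = 1 + ∑_{n ≥ 1} Tr (∧ⁿ A)`, as a function
of the trace class operator `A`. -/
def fredholmDet (A : H →L[ℂ] H) : ℂ := 1 + ∑' n : ℕ, traceWedge (n + 1) A

end Operators

section Splitting

variable {H : Type*} [NormedAddCommGroup H] [InnerProductSpace ℂ H] [CompleteSpace H]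
  (H₁ : Submodule ℂ H) [H₁.HasOrthogonalProjection]

/-- The even (block diagonal) part of `A` for the splitting `H = H₁ ⊕ H₂`, `H₂ = H₁ᗮ`. -/
def evenPart (A : H →L[ℂ] H) : H →L[ℂ] H :=
  H₁.starProjection * A * H₁.starProjection + H₁ᗮ.starProjection * A * H₁ᗮ.starProjection

/-- The odd (block off-diagonal) part of `A` for the splitting `H = H₁ ⊕ H₂`, `H₂ = H₁ᗮ`. -/
def oddPart (A : H →L[ℂ] H) : H →L[ℂ] H :=
  H₁.starProjection * A * H₁ᗮ.starProjection + H₁ᗮ.starProjection * A * H₁.starProjection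

/-- The class `𝓛_{1|2}(H)`. -/
def L12 : Set (H →L[ℂ] H) :=
  {A | IsTraceClass (evenPart H₁ A) ∧ IsHilbertSchmidt (oddPart H₁ A)}

/-- The extended Fredholm determinant
`Det (1 + A) = Det ((1 + A) e^{-A}) · e^{Tr A_even}`, as a function of `A ∈ 𝓛_{1|2}(H)`.
The first factor is the classical Fredholm determinant of `1 + R`, `R = (1 + A) e^{-A} - 1`. -/
def extDet (A : H →L[ℂ] H) : ℂ :=
  fredholmDet ((1 + A) * NormedSpace.exp (-A) - 1) * Complex.exp (trace (evenPart H₁ A))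

/-- `D` is an extension of the classical Fredholm determinant `A ↦ Det (1 + A)` from the trace
class to `𝓛_{1|2}(H)`, continuous for the topology given by the trace norm of the even part and
the Hilbert-Schmidt norm of the odd part. -/
def IsContinuousExtension (D : (H →L[ℂ] H) → ℂ) : Prop :=
  (∀ A : H →L[ℂ] H, IsTraceClass A → D A = fredholmDet A) ∧
  ∀ A ∈ L12 H₁, ∀ ε > 0, ∃ δ > 0, ∀ B ∈ L12 H₁,
    traceNorm (evenPart H₁ (B - A)) < δ → hsNorm (oddPart H₁ (B - A)) < δ → ‖D B - D A‖ < ε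

/-- `Tr (A^k)` for `k ≥ 2`, with the convention `Tr (A) := Tr (A_even)` for `k = 1`. -/
def powTrace (A : H →L[ℂ] H) (k : ℕ) : ℂ :=
  if k = 1 then trace (evenPart H₁ A) else trace (A ^ k)

/-- `C_n(A) = (1/n!) ∑_{ξ ∈ S_n} sign ξ ∏_{η} Tr (A^{|η|})`, with `η` running over the cycles
of `ξ`: `ξ.partition.parts` is the multiset of all cycle lengths, fixed points being counted as
cycles of length `1`. -/
def cycleCoeff (n : ℕ) (A : H →L[ℂ] H) : ℂ :=
  (n.factorial : ℂ)⁻¹ * ∑ ξ : Equiv.Perm (Fin n),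
    ((Equiv.Perm.sign ξ : ℤ) : ℂ) * (ξ.partition.parts.map (powTrace H₁ A)).prod

end Splitting

end ExtDet

end

/-! Every `A` in `L12 H₁` is Hilbert-Schmidt, because the trace norm dominates the Hilbert-Schmidt
norm. The regularized determinant `regDet A = Det ((1 + A) e^{-A})` and the traces of `A ^ k`, `k ≥
2`, are controlled by the Hilbert-Schmidt norm; only `Tr A_even` needs the trace norm.

Continuity: `(1 + A) e^{-A} - 1 = A (A g(A))` with `g` norm-continuous, a product of two
Hilbert-Schmidt operators, and `Det (1 + C* D)` is continuous in Hilbert-Schmidt `C` and `D`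
(`HSTendsto.fredholmDet`, from Hadamard's inequality for principal minors and the Schwarz lemma).

The rest follows by compressing `A` to matrices `A_F` on finite sets `F` of basis vectors, where
`det (1 + A_F) e^{-tr A_F}` tends to `regDet A`. For trace-class `A` the two factors converge
separately, and `Tr A_even = Tr A` by cyclicity; this is the agreement with the classical
determinant.

For the expansion put `c = Tr A_even - tr A_F`. The Taylor coefficients of the entire function `det
(1 + z A_F) e^{cz}` satisfy Newton's identities with first power sum `Tr A_even`. The signed cycle
index satisfies the same recursion (`isNewtonSeries_signedCycleIndex`), so the two agree. The bound
`|det (1 + Y) e^{-tr Y}|² ≤ e^{‖Y‖₂²}` and Cauchy's estimate on `|z| = 2` bound the `n`-th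
coefficient by `M / 2 ^ n` with `M` independent of `F`, and dominated convergence gives the limit
over `F`. -/

noncomputable section

namespace ExtDet

/-! ### Hadamard-type bounds for finite determinants. -/

section FiniteDeterminants

open Matrix

open scoped InnerProductSpace ComplexOrder

variable {E : Type*} [NormedAddCommGroup E] [InnerProductSpace ℂ E]

/-- Hadamard's inequality in an orthonormal basis. -/
theorem norm_orthonormalBasis_det_le {n : ℕ} (b : OrthonormalBasis (Fin n) ℂ E) (f : Fin n → E) :
    ‖b.toBasis.det f‖ ≤ ∏ i, ‖f i‖ := by
  have : FiniteDimensional ℂ E := b.toBasis.finiteDimensional_of_finite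
  have h : Module.finrank ℂ E = Fintype.card (Fin n) := Module.finrank_eq_card_basis b.toBasis
  set g := InnerProductSpace.gramSchmidtOrthonormalBasis h f with hg
  have h1 : b.toBasis.det f = b.toBasis.det g * g.toBasis.det f := by
    have := b.toBasis.det_comp_basis g.toBasis LinearMap.id
    rw [Module.Basis.det_apply, Module.Basis.det_apply, Module.Basis.det_apply, ← det_mul,
      ← OrthonormalBasis.coe_toBasis g, Module.Basis.toMatrix_mul_toMatrix]
  rw [h1, norm_mul, OrthonormalBasis.det_to_matrix_orthonormalBasis, one_mul, hg,
    InnerProductSpace.gramSchmidtOrthonormalBasis_det, norm_prod]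
  refine Finset.prod_le_prod (fun _ _ => norm_nonneg _) fun i _ => ?_
  refine (norm_inner_le_norm _ _).trans ?_
  simp

/-- For independent `u`, coordinates in an orthonormal basis of `span u` factor the matrix as `U*
V`, with each `v j` projected to the span, and Hadamard applies to both factors. For dependent `u`
the rows are dependent. -/
theorem norm_det_inner_fin_le {n : ℕ} (u v : Fin n → E) :
    ‖(of fun i j => ⟪u i, v j⟫_ℂ).det‖ ≤ (∏ i, ‖u i‖) * ∏ i, ‖v i‖ := by
  by_cases hu : LinearIndependent ℂ u
  · let W := Submodule.span ℂ (Set.range u)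
    have hW : Module.finrank ℂ W = n := by simpa using finrank_span_eq_card hu
    have : FiniteDimensional ℂ W := FiniteDimensional.span_of_finite ℂ (Set.finite_range u)
    let b : OrthonormalBasis (Fin n) ℂ W := (stdOrthonormalBasis ℂ W).reindex (finCongr hW)
    let u' : Fin n → W := fun i => ⟨u i, Submodule.subset_span ⟨i, rfl⟩⟩
    let v' : Fin n → W := fun i => W.orthogonalProjectionOnto (v i)
    have key : (of fun i j => ⟪u i, v j⟫_ℂ) = (b.toBasis.toMatrix u')ᴴ * b.toBasis.toMatrix v' := by
      ext i j
      have h1 : ⟪u i, v j⟫_ℂ = ⟪u' i, v' j⟫_ℂ := by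
        exact (Submodule.inner_orthogonalProjectionOnto_eq_of_mem_left (u' i) (v j)).symm
      rw [of_apply, h1, ← b.sum_inner_mul_inner, mul_apply]
      refine Finset.sum_congr rfl fun k _ => ?_
      simp [Module.Basis.toMatrix_apply, OrthonormalBasis.repr_apply_apply]
    rw [key, det_mul, det_conjTranspose, norm_mul, norm_star]
    refine mul_le_mul (norm_orthonormalBasis_det_le b u')
      ((norm_orthonormalBasis_det_le b v').trans
        (Finset.prod_le_prod (fun _ _ => norm_nonneg _) fun i _ => ?_)) (norm_nonneg _)
      (Finset.prod_nonneg fun _ _ => norm_nonneg _)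
    exact W.norm_orthogonalProjectionOnto_apply_le (v i)
  · rw [Fintype.linearIndependent_iff] at hu
    push Not at hu
    obtain ⟨c, hc, i, hi⟩ := hu
    have : (of fun i j => ⟪u i, v j⟫_ℂ).det = 0 := by
      refine exists_vecMul_eq_zero_iff.mp ⟨star c, ?_, ?_⟩
      · intro h
        exact hi (by simpa using congrFun h i)
      · ext j
        have : ⟪∑ i, c i • u i, v j⟫_ℂ = 0 := by rw [hc, inner_zero_left]
        simpa [vecMul, dotProduct, sum_inner, inner_smul_left, mul_comm] using this
    rw [this, norm_zero]
    positivity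

/-- The generalized Hadamard inequality `|det ⟨uᵢ, vⱼ⟩| ≤ ∏ ‖uᵢ‖ ‖vᵢ‖`. -/
theorem norm_det_inner_le {κ : Type*} [Fintype κ] [DecidableEq κ] (u v : κ → E) :
    ‖(of fun i j => ⟪u i, v j⟫_ℂ).det‖ ≤ ∏ i, ‖u i‖ * ‖v i‖ := by
  let e := Fintype.equivFin κ
  have h := norm_det_inner_fin_le (u ∘ e.symm) (v ∘ e.symm)
  have h2 : (of fun i j => ⟪(u ∘ e.symm) i, (v ∘ e.symm) j⟫_ℂ) =
      (of fun i j => ⟪u i, v j⟫_ℂ).submatrix e.symm e.symm := rfl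
  rw [h2, det_submatrix_equiv_self, ← Finset.prod_mul_distrib] at h
  refine h.trans_eq ?_
  exact e.symm.prod_comp fun i => ‖u i‖ * ‖v i‖

variable {κ : Type*} [Fintype κ] [DecidableEq κ]

/-- Multiply `λ ≤ exp (λ - 1)` over the eigenvalues. -/
theorem norm_det_le_of_posSemidef {M : Matrix κ κ ℂ} (hM : M.PosSemidef) :
    ‖M.det‖ ≤ Real.exp (M.trace.re - Fintype.card κ) := by
  rw [hM.1.det_eq_prod_eigenvalues, hM.1.trace_eq_sum_eigenvalues, norm_prod]
  have : ((∑ i, (hM.1.eigenvalues i : ℂ)).re - Fintype.card κ : ℝ) =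
      ∑ i, (hM.1.eigenvalues i - 1) := by simp
  erw [this]
  rw [Real.exp_sum]
  refine Finset.prod_le_prod (fun _ _ => norm_nonneg _) fun i _ => ?_
  have h0 := hM.eigenvalues_nonneg i
  have := Real.add_one_le_exp (hM.1.eigenvalues i - 1)
  simpa [abs_of_nonneg h0] using this

/-- Apply the positive semidefinite bound to `(1 + Y)ᴴ (1 + Y)`: the trace of the identity cancels
the dimension, so the estimate is dimension-free. -/
theorem norm_det_one_add_sq_le (Y : Matrix κ κ ℂ) :
    ‖(1 + Y).det‖ ^ 2 ≤ Real.exp (2 * Y.trace.re + ∑ i, ∑ j, ‖Y i j‖ ^ 2) := by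
  have h := norm_det_le_of_posSemidef (posSemidef_conjTranspose_mul_self (1 + Y))
  rw [det_mul, det_conjTranspose, norm_mul, norm_star, ← sq] at h
  refine h.trans_eq ?_
  congr 1
  have h1 : (Yᴴ * Y).trace.re = ∑ i, ∑ j, ‖Y i j‖ ^ 2 := by
    refine Eq.trans ?_ Finset.sum_comm
    rw [Matrix.trace, Complex.re_sum]
    refine Finset.sum_congr rfl fun i _ => ?_
    rw [diag_apply, mul_apply, Complex.re_sum]
    refine Finset.sum_congr rfl fun j _ => ?_
    rw [conjTranspose_apply]
    rw [Complex.star_def, ← Complex.normSq_eq_conj_mul_self, Complex.ofReal_re,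
      Complex.normSq_eq_norm_sq]
  have h2 : (1 + Y)ᴴ * (1 + Y) = 1 + Y + Yᴴ + Yᴴ * Y := by
    rw [conjTranspose_add, conjTranspose_one]; noncomm_ring
  rw [h2, trace_add, trace_add, trace_add, trace_one, trace_conjTranspose]
  simp only [Complex.add_re, h1]
  simp
  ring

/-- Bound for the regularized determinant `det (1 + Y) e^{- tr Y}`. -/
theorem norm_det_one_add_mul_exp_le (Y : Matrix κ κ ℂ) (c : ℂ) :
    ‖(1 + Y).det * Complex.exp (c - Y.trace)‖ ≤
      Real.exp (‖c‖ + ∑ i, ∑ j, ‖Y i j‖ ^ 2) := by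
  -- After squaring, the trace of `Y` cancels and the exponent is `2 Re c + ∑ ‖Y i j‖²`; the claimed
  -- bound has room to spare.
  refine le_of_sq_le_sq ?_ (Real.exp_nonneg _)
  rw [norm_mul, mul_pow, Complex.norm_exp]
  refine (mul_le_mul_of_nonneg_right (norm_det_one_add_sq_le Y) (by positivity)).trans ?_
  rw [← Real.exp_nat_mul, ← Real.exp_nat_mul, ← Real.exp_add, Real.exp_le_exp]
  have h1 := Complex.re_le_norm c
  have h2 : 0 ≤ ∑ i, ∑ j, ‖Y i j‖ ^ 2 := by positivity
  simp only [Complex.sub_re]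
  push_cast
  linarith

end FiniteDeterminants

/-! ### Newton's identities for `det (1 + X Y)`. -/

section PowerSums

open Matrix

variable {κ : Type*} [Fintype κ] [DecidableEq κ]

/-- Jacobi's formula. -/
theorem derivative_det (M : Matrix κ κ (Polynomial ℂ)) :
    Polynomial.derivative M.det = (M.adjugate * M.map Polynomial.derivative).trace := by
  have h1 : ∀ i, (M.adjugate * M.map Polynomial.derivative) i i =
      (M.updateCol i fun j => Polynomial.derivative (M j i)).det := by
    intro i
    rw [← cramer_apply, cramer_eq_adjugate_mulVec]
    rfl
  simp only [Matrix.trace, diag_apply, h1, det_apply']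
  rw [Finset.sum_comm, Polynomial.derivative_sum]
  refine Finset.sum_congr rfl fun σ _ => ?_
  rw [← Finset.mul_sum]
  have : ((Equiv.Perm.sign σ : ℤ) : Polynomial ℂ) = Polynomial.C ((Equiv.Perm.sign σ : ℤ) : ℂ) := by
    simp
  rw [this, Polynomial.derivative_C_mul, Polynomial.derivative_prod_finset]
  congr 1
  refine Finset.sum_congr rfl fun i _ => ?_
  rw [← Finset.mul_prod_erase _ _ (Finset.mem_univ i), updateCol_self, mul_comm]
  congr 1
  refine Finset.prod_congr rfl fun j hj => ?_
  rw [updateCol_ne (Finset.ne_of_mem_erase hj)]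

/-- The characteristic series `det (1 + X Y)`. -/
def detSeries (Y : Matrix κ κ ℂ) : Polynomial ℂ :=
  (1 + (Polynomial.X : Polynomial ℂ) • Y.map Polynomial.C).det

theorem eval_detSeries (Y : Matrix κ κ ℂ) (z : ℂ) :
    (detSeries Y).eval z = (1 + z • Y).det := by
  rw [detSeries, eval_det]
  congr 1
  ext i j
  simp [one_apply, mul_comm]

/-- With `M = 1 + X Y` and `q k = tr (adj M · Y ^ (k + 1))`, the relation `adj M · M = det M` gives
`q k = det M · tr Y ^ (k + 1) - X q (k + 1)`, while Jacobi's formula says that the derivative of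
`det M` is `q 0`. Unwinding the recursion gives the coefficients. -/
theorem succ_mul_coeff_detSeries (Y : Matrix κ κ ℂ) (n : ℕ) :
    ((n : ℂ) + 1) * (detSeries Y).coeff (n + 1) =
      ∑ p ∈ Finset.HasAntidiagonal.antidiagonal n, (detSeries Y).coeff p.1 * ((-1) ^ p.2 * (Y ^
          (p.2 + 1)).trace) := by
  set M : Matrix κ κ (Polynomial ℂ) := 1 + (Polynomial.X : Polynomial ℂ) • Y.map Polynomial.C with
      hM
  set q : ℕ → Polynomial ℂ := fun k => (M.adjugate * (Y ^ (k + 1)).map Polynomial.C).trace with hq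
  have hq1 : ∀ k, q k = detSeries Y * Polynomial.C (Y ^ (k + 1)).trace - Polynomial.X * q (k + 1)
      := by
    intro k
    have h := congrArg (fun N => (N * (Y ^ (k + 1)).map Polynomial.C).trace) (adjugate_mul M)
    simp only [smul_mul, one_mul, trace_smul] at h
    rw [eq_sub_iff_add_eq]
    have h3 : ((Y ^ (k + 1)).map Polynomial.C).trace = Polynomial.C (Y ^ (k + 1)).trace := by
      simp [Matrix.trace]
    rw [h3, smul_eq_mul] at h
    refine Eq.trans ?_ h
    have h4 : (Y ^ (k + 1 + 1)).map Polynomial.C = Y.map Polynomial.C * (Y ^ (k + 1)).map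
        Polynomial.C := by
      rw [pow_succ' Y (k + 1), Matrix.map_mul]
    simp only [hq]
    rw [h4, hM, mul_add, add_mul, trace_add, mul_one, Matrix.mul_smul, smul_mul, trace_smul,
        mul_assoc,
      smul_eq_mul]
  have hq0 : Polynomial.derivative (detSeries Y) = q 0 := by
    rw [detSeries, derivative_det]
    simp only [hq, zero_add, pow_one]
    congr 2
    ext i j : 1
    simp [one_apply, apply_ite]
  have hco : ∀ n k, (q k).coeff n = ∑ p ∈ Finset.HasAntidiagonal.antidiagonal n,
      (detSeries Y).coeff p.1 * ((-1) ^ p.2 * (Y ^ (p.2 + k + 1)).trace) := by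
    intro n
    induction n with
    | zero => intro k; rw [hq1]; simp
    | succ n ih =>
      intro k
      rw [hq1, Finset.Nat.sum_antidiagonal_succ', Polynomial.coeff_sub, Polynomial.coeff_mul_C,
        Polynomial.coeff_X_mul, ih]
      have : ∀ p : ℕ × ℕ, p.2 + 1 + k + 1 = p.2 + (k + 1) + 1 := by intro p; ring
      simp only [this, pow_succ (-1 : ℂ)]
      simp [sub_eq_add_neg, add_comm]
  have := congrArg (fun r => Polynomial.coeff r n) hq0
  simp only [Polynomial.coeff_derivative, hco] at this
  rw [mul_comm, this]

end PowerSums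

/-! ### Newton's recursion and entire generating functions. -/

section NewtonRecursion

/-- Newton's recursion between power sums `s` and elementary symmetric functions `a`. -/
structure IsNewtonSeries (s a : ℕ → ℂ) : Prop where
  zero : a 0 = 1
  succ : ∀ n : ℕ, ((n : ℂ) + 1) * a (n + 1) =
    ∑ p ∈ Finset.HasAntidiagonal.antidiagonal n, a p.1 * ((-1) ^ p.2 * s (p.2 + 1))

theorem IsNewtonSeries.unique {s a b : ℕ → ℂ} (ha : IsNewtonSeries s a)
    (hb : IsNewtonSeries s b) : a = b := by
  funext n
  induction n using Nat.strong_induction_on with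
  | _ n ih =>
    cases n with
    | zero => rw [ha.zero, hb.zero]
    | succ n =>
      have h0 : (n : ℂ) + 1 ≠ 0 := by exact_mod_cast n.succ_ne_zero
      apply mul_left_cancel₀ h0
      rw [ha.succ, hb.succ]
      refine Finset.sum_congr rfl fun p hp => ?_
      rw [ih p.1 (by have := Finset.HasAntidiagonal.mem_antidiagonal.mp hp; omega)]

-- The series is the product of `det (1 + X Y)` and `e^{cX}`. The exponential adds `c` to the
-- logarithmic derivative, so it shifts the first power sum and no other; this lets the first power
-- sum be prescribed at will.
open PowerSeries in
theorem exists_isNewtonSeries_hasSum {κ : Type*} [Fintype κ] [DecidableEq κ] (Y : Matrix κ κ ℂ)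
    (c : ℂ) {s : ℕ → ℂ} (h1 : s 1 = Y.trace + c) (hs : ∀ k, 2 ≤ k → s k = (Y ^ k).trace) :
    ∃ a : ℕ → ℂ, IsNewtonSeries s a ∧ ∀ z : ℂ, Summable (fun n => ‖a n * z ^ n‖) ∧
      ∑' n, a n * z ^ n = (1 + z • Y).det * Complex.exp (c * z) := by
  set P : PowerSeries ℂ := (detSeries Y : PowerSeries ℂ) with hP
  set E : PowerSeries ℂ := PowerSeries.mk fun n => c ^ n / (n.factorial : ℂ) with hE
  set Q : PowerSeries ℂ := PowerSeries.mk fun n => (-1) ^ n * (Y ^ (n + 1)).trace with hQ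
  have hdP : PowerSeries.derivative ℂ P = P * Q := by
    ext n
    rw [PowerSeries.coeff_derivative, PowerSeries.coeff_mul, hP, Polynomial.coeff_coe, mul_comm,
      succ_mul_coeff_detSeries]
    simp [hQ]
  have hdE : PowerSeries.derivative ℂ E = E * PowerSeries.C c := by
    ext n
    rw [PowerSeries.coeff_derivative, PowerSeries.coeff_mul_C, hE, PowerSeries.coeff_mk,
      PowerSeries.coeff_mk, Nat.factorial_succ]
    have h0 : (n : ℂ) + 1 ≠ 0 := by exact_mod_cast n.succ_ne_zero
    have h1 : (n.factorial : ℂ) ≠ 0 := by exact_mod_cast n.factorial_ne_zero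
    push_cast
    field_simp
    try ring
  have hd : PowerSeries.derivative ℂ (P * E) = P * E * (Q + PowerSeries.C c) := by
    rw [Derivation.leibniz, hdP, hdE, smul_eq_mul, smul_eq_mul]
    ring
  refine ⟨fun n => PowerSeries.coeff n (P * E), ⟨?_, fun n => ?_⟩, fun z => ?_⟩
  · have : (detSeries Y).coeff 0 = 1 := by
      rw [Polynomial.coeff_zero_eq_eval_zero, eval_detSeries]
      simp
    simp [PowerSeries.coeff_mul, hP, hE, this]
  · have := congrArg (PowerSeries.coeff n) hd
    rw [PowerSeries.coeff_derivative, PowerSeries.coeff_mul n (P * E)] at this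
    rw [mul_comm, this]
    refine Finset.sum_congr rfl fun p _ => ?_
    congr 1
    rcases p with ⟨i, j⟩
    cases j with
    | zero => simp [hQ, h1]
    | succ j => simp [hQ, hs (j + 1 + 1) (by omega)]
  · have hPs : ∀ n, n ∉ Finset.range ((detSeries Y).natDegree + 1) →
        PowerSeries.coeff n P * z ^ n = 0 := by
      intro n hn
      rw [hP, Polynomial.coeff_coe, Polynomial.coeff_eq_zero_of_natDegree_lt, zero_mul]
      rw [Finset.mem_range, not_lt] at hn
      omega
    have sP : Summable fun n => ‖PowerSeries.coeff n P * z ^ n‖ :=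
      summable_of_ne_finset_zero (s := Finset.range ((detSeries Y).natDegree + 1))
        fun n hn => by rw [hPs n hn, norm_zero]
    have tP : ∑' n, PowerSeries.coeff n P * z ^ n = (1 + z • Y).det := by
      rw [tsum_eq_sum hPs, ← eval_detSeries, Polynomial.eval_eq_sum_range]
      simp [hP]
    have eE : ∀ n, PowerSeries.coeff n E * z ^ n = (c * z) ^ n / (n.factorial : ℂ) := by
      intro n
      rw [hE, PowerSeries.coeff_mk, mul_pow]; ring
    have sE : Summable fun n => ‖PowerSeries.coeff n E * z ^ n‖ := by
      simp only [eE]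
      exact NormedSpace.norm_expSeries_div_summable (c * z)
    have tE : ∑' n, PowerSeries.coeff n E * z ^ n = Complex.exp (c * z) := by
      simp only [eE]
      rw [Complex.exp_eq_exp_ℂ, NormedSpace.exp_eq_tsum_div]
    have hc : ∀ n, PowerSeries.coeff n (P * E) * z ^ n = ∑ p ∈ Finset.HasAntidiagonal.antidiagonal
        n,
        (PowerSeries.coeff p.1 P * z ^ p.1) * (PowerSeries.coeff p.2 E * z ^ p.2) := by
      intro n
      rw [PowerSeries.coeff_mul, Finset.sum_mul]
      refine Finset.sum_congr rfl fun p hp => ?_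
      rw [← Finset.HasAntidiagonal.mem_antidiagonal.mp hp, pow_add]
      ring
    simp only [hc]
    have h1 := summable_norm_sum_mul_antidiagonal_of_summable_norm sP sE
    have h2 := tsum_mul_tsum_eq_tsum_sum_antidiagonal_of_summable_norm sP sE
    rw [tP, tE] at h2
    exact ⟨h1, h2.symm⟩

/-- Cauchy's estimates for the coefficients of an everywhere convergent power series. -/
theorem norm_coeff_le_of_forall_mem_sphere {a : ℕ → ℂ}
    (ha : ∀ z : ℂ, Summable fun n => ‖a n * z ^ n‖) {r M : ℝ} (hr : 0 < r)
    (hM : ∀ z ∈ Metric.sphere (0 : ℂ) r, ‖∑' n, a n * z ^ n‖ ≤ M) (n : ℕ) :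
    ‖a n‖ ≤ M / r ^ n := by
  set p := FormalMultilinearSeries.ofScalars ℂ a with hp
  have hrad : p.radius = ⊤ := by
    refine FormalMultilinearSeries.radius_eq_top_of_summable_norm _ fun ρ => ?_
    refine (ha (ρ : ℂ)).congr fun n => ?_
    simp [hp]
  have h := p.hasFPowerSeriesOnBall (by simp [hrad])
  have hsum : ∀ z, p.sum z = ∑' n, a n * z ^ n := fun z => by
    simp [FormalMultilinearSeries.sum, hp, mul_comm]
  have hdiff : Differentiable ℂ p.sum := by
    have := h.differentiableOn
    rw [hrad] at this
    intro z
    exact (this z (by simp)).differentiableAt (by simp)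
  have h1 := Complex.norm_iteratedDeriv_le_of_forall_mem_sphere_norm_le n hr
    hdiff.diffContOnCl (fun z hz => by rw [hsum]; exact hM z hz)
  have h2 : iteratedDeriv n p.sum 0 = n.factorial * a n := by
    have := h.factorial_smul 1 n
    rw [iteratedDeriv_eq_iteratedFDeriv, ← this]
    simp [hp]
  rw [h2, norm_mul, Complex.norm_natCast, mul_div_assoc] at h1
  exact le_of_mul_le_mul_left h1 (by positivity)

end NewtonRecursion

/-! ### The identity `det (exp Y) = exp (tr Y)`. -/

section DetExp

open Matrix

attribute [local instance] Matrix.linftyOpNormedRing Matrix.linftyOpNormedAlgebra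

variable {κ : Type*} [Fintype κ] [DecidableEq κ]

/-- By the Leibniz expansion the derivative depends only on `M t = 1` and `Y`, so it may be computed
on the affine path `1 + (s - t) Y`, where it is the linear coefficient of `detSeries Y`. -/
theorem hasDerivAt_det {M : ℂ → Matrix κ κ ℂ} {Y : Matrix κ κ ℂ} {t : ℂ} (h1 : M t = 1)
    (hM : ∀ i j, HasDerivAt (fun s => M s i j) (Y i j) t) :
    HasDerivAt (fun s => (M s).det) Y.trace t := by
  have key : ∀ N : ℂ → Matrix κ κ ℂ, N t = 1 → (∀ i j, HasDerivAt (fun s => N s i j) (Y i j) t) →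
      HasDerivAt (fun s => (N s).det) (∑ σ : Equiv.Perm κ, ((Equiv.Perm.sign σ : ℤ) : ℂ) *
        ∑ i, (∏ j ∈ Finset.univ.erase i, (1 : Matrix κ κ ℂ) (σ j) j) • Y (σ i) i) t := by
    intro N hN hN'
    simp only [det_apply']
    refine HasDerivAt.fun_sum fun σ _ => ?_
    refine HasDerivAt.const_mul _ ?_
    have := HasDerivAt.fun_finsetProd (u := Finset.univ) (x := t)
      (f := fun i s => N s (σ i) i) (f' := fun i => Y (σ i) i) fun i _ => hN' _ _
    simpa [hN] using this
  have h2 := key (fun s => 1 + (s - t) • Y) (by simp) fun i j => by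
    have := (((hasDerivAt_id t).sub_const t).mul_const (Y i j)).const_add ((1 : Matrix κ κ ℂ) i j)
    simpa using this
  have h3 : HasDerivAt (fun s : ℂ => (1 + (s - t) • Y).det) Y.trace t := by
    have hc : (detSeries Y).derivative.eval (t - t) = Y.trace := by
      have h0 : (detSeries Y).coeff 0 = 1 := by
        rw [Polynomial.coeff_zero_eq_eval_zero, eval_detSeries]
        simp
      have := succ_mul_coeff_detSeries Y 0
      rw [sub_self, ← Polynomial.coeff_zero_eq_eval_zero, Polynomial.coeff_derivative]
      simpa [h0] using this
    have h4 := ((detSeries Y).hasDerivAt (t - t)).comp (h := fun s => s - t) t ((hasDerivAt_id'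
        t).sub_const t)
    rw [hc, mul_one] at h4
    refine h4.congr_of_eventuallyEq (Filter.Eventually.of_forall fun s => ?_)
    exact (eval_detSeries Y (s - t)).symm
  rw [← h2.unique h3]
  exact key M h1 hM

/-- The function `det (exp (sY)) · e^{-s tr Y}` has zero derivative: the group law moves the
differentiation at `t` to the identity matrix. -/
theorem det_exp (Y : Matrix κ κ ℂ) : (NormedSpace.exp Y).det = Complex.exp Y.trace := by
  set g : ℂ → ℂ := fun s => (NormedSpace.exp (s • Y)).det * Complex.exp (-(s * Y.trace)) with hg
  have hadd : ∀ s t : ℂ, NormedSpace.exp (s • Y) =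
      NormedSpace.exp (t • Y) * NormedSpace.exp ((s - t) • Y) := by
    intro s t
    rw [← Matrix.exp_add_of_commute _ _ (((Commute.refl Y).smul_left t).smul_right (s - t)),
      ← add_smul, add_sub_cancel]
  have hd : ∀ t, HasDerivAt g 0 t := by
    intro t
    have h1 : HasDerivAt (fun s : ℂ => (NormedSpace.exp ((s - t) • Y)).det) Y.trace t := by
      refine hasDerivAt_det (by simp) fun i j => ?_
      have h2 := hasDerivAt_exp_smul_const (𝕂 := ℂ) Y (t - t)
      have h3 := HasDerivAt.scomp (h := fun s => s - t) t h2 ((hasDerivAt_id' t).sub_const t)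
      rw [sub_self, zero_smul, NormedSpace.exp_zero, one_mul, one_smul] at h3
      exact ((hasDerivAt_pi.mp h3 i) |> hasDerivAt_pi.mp) j
    have h4 : HasDerivAt (fun s : ℂ => (NormedSpace.exp (s • Y)).det)
        ((NormedSpace.exp (t • Y)).det * Y.trace) t := by
      refine (h1.const_mul (NormedSpace.exp (t • Y)).det).congr_of_eventuallyEq
        (Filter.Eventually.of_forall fun s => ?_)
      simp only []
      rw [hadd s t, det_mul]
    have h5 : HasDerivAt (fun s : ℂ => Complex.exp (-(s * Y.trace)))
        (Complex.exp (-(t * Y.trace)) * -Y.trace) t := by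
      have := (((hasDerivAt_id t).mul_const Y.trace).neg).cexp
      simpa using this
    have := h4.mul h5
    rwa [show (NormedSpace.exp (t • Y)).det * Y.trace * Complex.exp (-(t * Y.trace)) +
      (NormedSpace.exp (t • Y)).det * (Complex.exp (-(t * Y.trace)) * -Y.trace) = 0 by ring] at this
  have hconst := is_const_of_deriv_eq_zero (fun t => (hd t).differentiableAt)
    (fun t => (hd t).deriv) 1 0
  simp only [hg, one_smul, zero_smul, NormedSpace.exp_zero, det_one, one_mul, zero_mul, neg_zero,
    Complex.exp_zero] at hconst
  rw [Complex.exp_neg] at hconst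
  exact eq_of_mul_inv_eq_one hconst

end DetExp

/-! ### The signed cycle index as a sum over partitions. -/

section CycleIndex

/-- The order of the centralizer of a permutation with the cycle lengths `s`. -/
def centralizerCard (s : Multiset ℕ) : ℕ := s.prod * ∏ i ∈ s.toFinset, (s.count i).factorial

theorem prod_factorial_count_eq {s : Multiset ℕ} {T : Finset ℕ} (hT : s.toFinset ⊆ T) :
    ∏ i ∈ s.toFinset, (s.count i).factorial = ∏ i ∈ T, (s.count i).factorial := by
  refine Finset.prod_subset hT fun i _ hi => ?_
  rw [Multiset.mem_toFinset] at hi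
  rw [Multiset.count_eq_zero_of_notMem hi, Nat.factorial_zero]

theorem centralizerCard_cons (i : ℕ) (s : Multiset ℕ) :
    centralizerCard (i ::ₘ s) = (i ::ₘ s).count i * i * centralizerCard s := by
  rw [centralizerCard, centralizerCard, Multiset.prod_cons,
    prod_factorial_count_eq (s := s) (T := (i ::ₘ s).toFinset) (by simp)]
  have hi : i ∈ (i ::ₘ s).toFinset := by simp
  rw [← Finset.mul_prod_erase _ _ hi, ← Finset.mul_prod_erase _ _ hi, Multiset.count_cons_self,
    Nat.factorial_succ]
  have : ∏ j ∈ (i ::ₘ s).toFinset.erase i, ((i ::ₘ s).count j).factorial =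
      ∏ j ∈ (i ::ₘ s).toFinset.erase i, (s.count j).factorial :=
    Finset.prod_congr rfl fun j hj => by
      rw [Multiset.count_cons_of_ne (Finset.ne_of_mem_erase hj)]
  rw [this]
  ring

/-- The contribution of the permutations with cycle lengths `s` to the signed cycle index. -/
def cycleWeight (t : ℕ → ℂ) (s : Multiset ℕ) : ℂ :=
  (s.map fun i => (-1) ^ (i + 1) * t i).prod / (centralizerCard s : ℂ)

theorem count_mul_cycleWeight_cons (t : ℕ → ℂ) {i : ℕ} (hi : i ≠ 0) (s : Multiset ℕ) :
    (((i ::ₘ s).count i * i : ℕ) : ℂ) * cycleWeight t (i ::ₘ s) =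
      (-1) ^ (i + 1) * t i * cycleWeight t s := by
  have h : (((i ::ₘ s).count i * i : ℕ) : ℂ) ≠ 0 := by
    have : (i ::ₘ s).count i ≠ 0 := by simp
    exact_mod_cast mul_ne_zero this hi
  rw [cycleWeight, cycleWeight, centralizerCard_cons, Nat.cast_mul _ (centralizerCard s),
    Multiset.map_cons, Multiset.prod_cons, mul_div_assoc', mul_div_mul_left _ _ h, mul_div_assoc]

/-- The known count is by `cycleType`, which omits fixed points. Hence `p.parts` is split into `m`,
the parts at least `2`, and copies of `1`, whose multiplicity `n - m.sum` supplies the remaining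
factorial. -/
theorem card_partition_eq_mul_centralizerCard {n : ℕ} (p : n.Partition) :
    (Finset.univ.filter fun ξ : Equiv.Perm (Fin n) =>
      ξ.partition.parts = p.parts).card * centralizerCard p.parts = n.factorial := by
  set m := p.parts.filter fun i => 2 ≤ i with hm
  have hp : p.parts = m + Multiset.replicate (p.parts.count 1) 1 := by
    conv_lhs => rw [← Multiset.filter_add_not (fun i => 2 ≤ i) p.parts]
    congr 1
    rw [← Multiset.filter_eq']
    refine Multiset.filter_congr fun i hi => ?_
    have := p.parts_pos hi
    omega
  have hsum : n = m.sum + p.parts.count 1 := by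
    have := p.parts_sum
    rw [hp] at this
    simpa using this.symm
  have hcard := Equiv.Perm.card_of_cycleType_mul_eq (Fin n) m
  rw [if_pos ⟨by rw [Fintype.card_fin]; omega, fun a ha => (Multiset.mem_filter.mp ha).2⟩,
    Fintype.card_fin] at hcard
  have hset : (Finset.univ.filter fun ξ : Equiv.Perm (Fin n) => ξ.partition.parts = p.parts) =
      Finset.univ.filter fun ξ : Equiv.Perm (Fin n) => ξ.cycleType = m := by
    refine Finset.filter_congr fun ξ _ => ⟨fun h => ?_, fun h => ?_⟩
    · rw [← Equiv.Perm.filter_parts_partition_eq_cycleType, h]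
    · rw [Equiv.Perm.parts_partition, h, ← Equiv.Perm.sum_cycleType, h, Fintype.card_fin]
      conv_rhs => rw [hp]
      congr 2
      omega
  have hz : centralizerCard p.parts =
      (n - m.sum).factorial * m.prod * ∏ i ∈ m.toFinset, (m.count i).factorial := by
    have h1 : n - m.sum = p.parts.count 1 := by omega
    -- Inserting `1` treats partitions with and without fixed points alike.
    rw [centralizerCard, h1, prod_factorial_count_eq (T := insert 1 p.parts.toFinset) (by simp),
      prod_factorial_count_eq (s := m) (T := p.parts.toFinset.erase 1), ← Finset.mul_prod_erase _ _
      (Finset.mem_insert_self 1 p.parts.toFinset), Finset.erase_insert_eq_erase]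
    · have h2 : p.parts.prod = m.prod := by rw [hp]; simp
      have h3 : ∏ i ∈ p.parts.toFinset.erase 1, (p.parts.count i).factorial =
          ∏ i ∈ p.parts.toFinset.erase 1, (m.count i).factorial := by
        refine Finset.prod_congr rfl fun i hi => ?_
        rw [hm, Multiset.count_filter_of_pos]
        have h4 := p.parts_pos (Multiset.mem_toFinset.mp (Finset.mem_of_mem_erase hi))
        have h5 := Finset.ne_of_mem_erase hi
        omega
      rw [h2, h3]
      ring
    · intro i hi
      rw [Multiset.mem_toFinset, hm, Multiset.mem_filter] at hi
      exact Finset.mem_erase.mpr ⟨by omega, Multiset.mem_toFinset.mpr hi.1⟩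
  rw [hset, hz, hcard]

theorem sign_eq_prod_parts {n : ℕ} (ξ : Equiv.Perm (Fin n)) :
    ((Equiv.Perm.sign ξ : ℤ) : ℂ) = (ξ.partition.parts.map fun i => (-1 : ℂ) ^ (i + 1)).prod := by
  rw [Equiv.Perm.sign_of_cycleType', Equiv.Perm.parts_partition, Multiset.map_add,
    Multiset.prod_add, Multiset.map_replicate, Multiset.prod_replicate]
  simp only [one_add_one_eq_two, neg_one_sq, one_pow, mul_one]
  generalize ξ.cycleType = m
  induction m using Multiset.induction_on with
  | empty => simp
  | cons a s ih =>
    simp only [Multiset.map_cons, Multiset.prod_cons, Units.val_mul, Int.cast_mul, ih]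
    congr 1
    simp [pow_succ]

/-- The signed cycle index with the variables `t k`, one for each cycle length. -/
def signedCycleIndex (t : ℕ → ℂ) (n : ℕ) : ℂ :=
  (n.factorial : ℂ)⁻¹ * ∑ ξ : Equiv.Perm (Fin n),
    ((Equiv.Perm.sign ξ : ℤ) : ℂ) * (ξ.partition.parts.map t).prod

/-- The summand depends only on the cycle lengths, so permutations are grouped into classes of size
`n! / centralizerCard`. -/
theorem signedCycleIndex_eq_sum_partition (t : ℕ → ℂ) (n : ℕ) :
    signedCycleIndex t n = ∑ p : n.Partition, cycleWeight t p.parts := by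
  have hn : (n.factorial : ℂ) ≠ 0 := by exact_mod_cast n.factorial_ne_zero
  rw [signedCycleIndex, inv_mul_eq_iff_eq_mul₀ hn, Finset.mul_sum]
  let f : Equiv.Perm (Fin n) → n.Partition := fun ξ =>
    ⟨ξ.partition.parts, ξ.partition.parts_pos, by rw [ξ.partition.parts_sum, Fintype.card_fin]⟩
  rw [← Finset.sum_fiberwise (s := Finset.univ) (g := f)]
  refine Finset.sum_congr rfl fun p _ => ?_
  have h1 : ∀ ξ ∈ Finset.univ.filter (fun ξ => f ξ = p),
      ((Equiv.Perm.sign ξ : ℤ) : ℂ) * (ξ.partition.parts.map t).prod =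
        (p.parts.map fun i => (-1) ^ (i + 1) * t i).prod := by
    intro ξ hξ
    have : ξ.partition.parts = p.parts := congrArg Nat.Partition.parts (Finset.mem_filter.mp hξ).2
    rw [sign_eq_prod_parts, ← Multiset.prod_map_mul, this]
  rw [Finset.sum_congr rfl h1, Finset.sum_const, nsmul_eq_mul]
  have h2 : Finset.univ.filter (fun ξ => f ξ = p) =
      Finset.univ.filter fun ξ : Equiv.Perm (Fin n) => ξ.partition.parts = p.parts :=
    Finset.filter_congr fun ξ _ => Nat.Partition.ext_iff
  have h3 := card_partition_eq_mul_centralizerCard p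
  have h4 : (centralizerCard p.parts : ℂ) ≠ 0 := by
    intro h
    rw [Nat.cast_eq_zero] at h
    rw [h, mul_zero] at h3
    exact n.factorial_ne_zero h3.symm
  rw [h2, cycleWeight, ← h3]
  push_cast
  field_simp

/-- The signed cycle index satisfies Newton's recursion. -/
theorem isNewtonSeries_signedCycleIndex (t : ℕ → ℂ) :
    IsNewtonSeries t (signedCycleIndex t) := by
  constructor
  · rw [signedCycleIndex_eq_sum_partition]
    simp [cycleWeight, centralizerCard]
  · intro n
    simp only [signedCycleIndex_eq_sum_partition]
    -- The factor `n + 1` is written as the sum of the parts: a part size `q.2 + 1` contributes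
    -- itself times its multiplicity.
    have h1 : ∀ p : (n + 1).Partition, ((n : ℂ) + 1) * cycleWeight t p.parts =
        ∑ q ∈ Finset.HasAntidiagonal.antidiagonal n, if q.2 + 1 ∈ p.parts then
          ((p.parts.count (q.2 + 1) * (q.2 + 1) : ℕ) : ℂ) * cycleWeight t p.parts else 0 := by
      intro p
      have h2 : n + 1 = ∑ q ∈ Finset.HasAntidiagonal.antidiagonal n,
          if q.2 + 1 ∈ p.parts then p.parts.count (q.2 + 1) * (q.2 + 1) else 0 := by
        have h4 := Finset.Nat.sum_antidiagonal_swap (n := n) (f := fun q : ℕ × ℕ =>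
          if q.2 + 1 ∈ p.parts then p.parts.count (q.2 + 1) * (q.2 + 1) else 0)
        rw [← h4, Finset.Nat.sum_antidiagonal_eq_sum_range_succ_mk]
        have h5 := Finset.sum_range_succ' (fun i =>
          if i ∈ p.parts then p.parts.count i * i else 0) (n + 1)
        simp only [mul_zero, ite_self, add_zero] at h5
        simp only [Prod.snd_swap]
        rw [← h5, ← Finset.sum_filter]
        conv_lhs => rw [← p.parts_sum]
        rw [Finset.sum_multiset_count]
        simp only [smul_eq_mul]
        refine Finset.sum_congr ?_ fun _ _ => rfl
        ext i
        simp only [Multiset.mem_toFinset, Finset.mem_filter, Finset.mem_range]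
        exact ⟨fun h => ⟨by have := Nat.Partition.le_of_mem_parts h; omega, h⟩, fun h => h.2⟩
      have h3 : ((n : ℂ) + 1) = ((n + 1 : ℕ) : ℂ) := by push_cast; rfl
      rw [h3.trans (congrArg Nat.cast h2), Nat.cast_sum, Finset.sum_mul]
      refine Finset.sum_congr rfl fun q _ => ?_
      split_ifs <;> simp
    rw [Finset.mul_sum, Finset.sum_congr rfl fun p _ => h1 p, Finset.sum_comm]
    refine Finset.sum_congr rfl fun q hq => ?_
    have hq := Finset.HasAntidiagonal.mem_antidiagonal.mp hq
    rw [← Finset.sum_filter, Finset.sum_mul]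
    have hn : n + 1 - (q.2 + 1) = q.1 := by omega
    have h4 : ∀ {m m' : ℕ}, m = m' → ∀ F : Multiset ℕ → ℂ,
        ∑ r : m.Partition, F r.parts = ∑ r : m'.Partition, F r.parts := by
      rintro m _ rfl F
      rfl
    rw [← h4 hn fun s => cycleWeight t s * ((-1) ^ q.2 * t (q.2 + 1)),
      Finset.sum_subtype (p := fun p : (n + 1).Partition => q.2 + 1 ∈ p.parts) _ (by simp)]
    -- Erasing one part `q.2 + 1` is a bijection onto the partitions of `q.1`, and multiplicity
    -- times size is the factor by which the centralizer order drops.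
    refine Fintype.sum_equiv (Nat.Partition.partitionWithPartEquiv (n := n + 1) (a := q.2 + 1)
      (by omega) (by omega)) _ _ fun p => ?_
    rw [Nat.Partition.partitionWithPartEquiv_apply_parts]
    have h5 := count_mul_cycleWeight_cons t (i := q.2 + 1) (by omega) (p.1.parts.erase (q.2 + 1))
    rw [Multiset.cons_erase p.2] at h5
    rw [h5]
    ring

end CycleIndex

/-! ### Hilbert-Schmidt operators and convergence in their norm. -/

section HilbertSchmidt

open scoped InnerProductSpace ENNReal Topology
open Filter ContinuousLinearMap

variable {H : Type*} [NormedAddCommGroup H] [InnerProductSpace ℂ H] [CompleteSpace H]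

/-- The square of the Hilbert-Schmidt norm, as an extended nonnegative real number. -/
def hsSq (A : H →L[ℂ] H) : ℝ≥0∞ := ∑' i, ‖A (stdBasis H i)‖ₑ ^ 2

theorem enorm_sq_eq_ofReal {E : Type*} [SeminormedAddCommGroup E] (x : E) :
    ‖x‖ₑ ^ 2 = ENNReal.ofReal (‖x‖ ^ 2) := by
  rw [← ofReal_norm, ENNReal.ofReal_pow (norm_nonneg _)]

theorem enorm_add_sq_le {E : Type*} [SeminormedAddCommGroup E] (x y : E) :
    ‖x + y‖ₑ ^ 2 ≤ 2 * (‖x‖ₑ ^ 2 + ‖y‖ₑ ^ 2) := by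
  have h : ‖x + y‖ ^ 2 ≤ 2 * (‖x‖ ^ 2 + ‖y‖ ^ 2) :=
    (pow_le_pow_left₀ (norm_nonneg _) (norm_add_le x y) 2).trans add_sq_le
  rw [enorm_sq_eq_ofReal, enorm_sq_eq_ofReal, enorm_sq_eq_ofReal,
    ← ENNReal.ofReal_add (by positivity) (by positivity), ← ENNReal.ofReal_ofNat,
    ← ENNReal.ofReal_mul (by positivity)]
  exact ENNReal.ofReal_le_ofReal h

theorem isHilbertSchmidt_iff {A : H →L[ℂ] H} : IsHilbertSchmidt A ↔ hsSq A ≠ ⊤ := by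
  rw [IsHilbertSchmidt, hsSq]
  simp only [enorm_sq_eq_ofReal]
  refine ⟨fun h => h.tsum_ofReal_ne_top, fun h => ?_⟩
  refine (ENNReal.summable_toReal h).congr fun i => ?_
  rw [ENNReal.toReal_ofReal (by positivity)]

theorem hsSq_eq_ofReal_hsNorm {A : H →L[ℂ] H} (hA : IsHilbertSchmidt A) :
    hsSq A = ENNReal.ofReal (hsNorm A ^ 2) := by
  rw [hsNorm, Real.sq_sqrt (tsum_nonneg fun _ => by positivity),
    ENNReal.ofReal_tsum_of_nonneg (fun _ => by positivity) hA, hsSq]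
  simp only [enorm_sq_eq_ofReal]

theorem tsum_enorm_inner_stdBasis_sq (x : H) : ∑' i, ‖⟪stdBasis H i, x⟫_ℂ‖ₑ ^ 2 = ‖x‖ₑ ^ 2 := by
  have h := (stdBasis H).hasSum_inner_mul_inner x x
  have h1 : HasSum (fun i => ‖⟪stdBasis H i, x⟫_ℂ‖ ^ 2) (‖x‖ ^ 2) := by
    rw [← Complex.hasSum_ofReal]
    have h2 : ⟪x, x⟫_ℂ = ((‖x‖ ^ 2 : ℝ) : ℂ) := by
      rw [inner_self_eq_norm_sq_to_K]; push_cast; rfl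
    rw [← h2]
    refine h.congr_fun fun i => ?_
    rw [← inner_conj_symm x, ← Complex.normSq_eq_conj_mul_self, Complex.normSq_eq_norm_sq]
  simp only [enorm_sq_eq_ofReal]
  rw [← ENNReal.ofReal_tsum_of_nonneg (fun _ => by positivity) h1.summable, h1.tsum_eq]

theorem hsSq_adjoint (A : H →L[ℂ] H) : hsSq (adjoint A) = hsSq A := by
  simp only [hsSq, ← tsum_enorm_inner_stdBasis_sq (adjoint A _), ← tsum_enorm_inner_stdBasis_sq (A
      _)]
  rw [ENNReal.tsum_comm]
  refine tsum_congr fun i => tsum_congr fun j => ?_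
  rw [adjoint_inner_right, ← inner_conj_symm, enorm_sq_eq_ofReal, enorm_sq_eq_ofReal,
    RCLike.norm_conj]

theorem hsSq_mul_le (X A : H →L[ℂ] H) : hsSq (X * A) ≤ ‖X‖ₑ ^ 2 * hsSq A := by
  rw [hsSq, hsSq, ← ENNReal.tsum_mul_left]
  refine ENNReal.tsum_le_tsum fun i => ?_
  rw [← mul_pow]
  exact pow_le_pow_left' (X.le_opENorm _) 2

theorem enorm_adjoint (X : H →L[ℂ] H) : ‖adjoint X‖ₑ = ‖X‖ₑ := by
  rw [← ofReal_norm, ← ofReal_norm, LinearIsometryEquiv.norm_map]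

theorem hsSq_mul_le' (A X : H →L[ℂ] H) : hsSq (A * X) ≤ ‖X‖ₑ ^ 2 * hsSq A := by
  rw [← hsSq_adjoint, ← hsSq_adjoint A, ← enorm_adjoint X]
  have : adjoint (A * X) = adjoint X * adjoint A := adjoint_comp A X
  rw [this]
  exact hsSq_mul_le _ _

theorem hsSq_add_le (A B : H →L[ℂ] H) : hsSq (A + B) ≤ 2 * (hsSq A + hsSq B) := by
  rw [hsSq, hsSq, hsSq, ← ENNReal.tsum_add, ← ENNReal.tsum_mul_left]
  exact ENNReal.tsum_le_tsum fun i => enorm_add_sq_le _ _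

theorem hsSq_neg (A : H →L[ℂ] H) : hsSq (-A) = hsSq A := by
  simp [hsSq]

theorem hsSq_sub_le (A B : H →L[ℂ] H) : hsSq (A - B) ≤ 2 * (hsSq A + hsSq B) := by
  rw [sub_eq_add_neg, ← hsSq_neg B]
  exact hsSq_add_le _ _

theorem tsum_mul_le_sqrt_mul_sqrt {ι : Type*} (f g : ι → ℝ≥0∞) :
    ∑' i, f i * g i ≤ (∑' i, f i ^ 2) ^ (1 / 2 : ℝ) * (∑' i, g i ^ 2) ^ (1 / 2 : ℝ) := by
  rw [ENNReal.tsum_eq_iSup_sum]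
  refine iSup_le fun s => (ENNReal.inner_le_Lp_mul_Lq s f g Real.HolderConjugate.two_two).trans ?_
  simp only [ENNReal.rpow_two]
  gcongr <;> exact ENNReal.sum_le_tsum s

theorem enorm_inner_le_enorm_mul_enorm {E : Type*} [NormedAddCommGroup E] [InnerProductSpace ℂ E]
    (x y : E) : ‖⟪x, y⟫_ℂ‖ₑ ≤ ‖x‖ₑ * ‖y‖ₑ := by
  rw [← ofReal_norm, ← ofReal_norm, ← ofReal_norm, ← ENNReal.ofReal_mul (norm_nonneg _)]
  exact ENNReal.ofReal_le_ofReal (norm_inner_le_norm _ _)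

/-- Pass to the adjoint: Parseval for `A* x` has terms `|⟪A eᵢ, x⟫|² ≤ ‖A eᵢ‖² ‖x‖²`. -/
theorem enorm_sq_le_hsSq (A : H →L[ℂ] H) : ‖A‖ₑ ^ 2 ≤ hsSq A := by
  have h1 : ‖A‖ₑ ≤ hsSq A ^ (1 / 2 : ℝ) := by
    rw [← enorm_adjoint]
    refine opENorm_le_bound _ fun x => ?_
    have h2 : ‖adjoint A x‖ₑ ^ 2 ≤ hsSq A * ‖x‖ₑ ^ 2 := by
      rw [← tsum_enorm_inner_stdBasis_sq, hsSq, ← ENNReal.tsum_mul_right]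
      refine ENNReal.tsum_le_tsum fun i => ?_
      rw [adjoint_inner_right, ← mul_pow]
      exact pow_le_pow_left' (enorm_inner_le_enorm_mul_enorm _ _) 2
    have h3 := ENNReal.rpow_le_rpow h2 (z := 1 / 2) (by norm_num)
    rw [ENNReal.mul_rpow_of_nonneg _ _ (by norm_num), ← ENNReal.rpow_two, ← ENNReal.rpow_two,
      ← ENNReal.rpow_mul, ← ENNReal.rpow_mul] at h3
    simpa using h3
  calc ‖A‖ₑ ^ 2 ≤ (hsSq A ^ (1 / 2 : ℝ)) ^ 2 := pow_le_pow_left' h1 2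
    _ = hsSq A := by rw [← ENNReal.rpow_two, ← ENNReal.rpow_mul]; simp

/-- The Hilbert-Schmidt inner product `Tr (C* D)`. -/
def hsInner (C D : H →L[ℂ] H) : ℂ := ∑' i, ⟪C (stdBasis H i), D (stdBasis H i)⟫_ℂ

theorem trace_adjoint_mul (C D : H →L[ℂ] H) : trace (adjoint C * D) = hsInner C D :=
  tsum_congr fun i => by
    change ⟪_, adjoint C (D _)⟫_ℂ = _
    rw [adjoint_inner_right]

theorem tsum_enorm_inner_le (C D : H →L[ℂ] H) :
    ∑' i, ‖⟪C (stdBasis H i), D (stdBasis H i)⟫_ℂ‖ₑ ≤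
      hsSq C ^ (1 / 2 : ℝ) * hsSq D ^ (1 / 2 : ℝ) :=
  (ENNReal.tsum_le_tsum fun _ => enorm_inner_le_enorm_mul_enorm _ _).trans
    (tsum_mul_le_sqrt_mul_sqrt _ _)

theorem sqrt_hsSq_mul_ne_top {C D : H →L[ℂ] H} (hC : hsSq C ≠ ⊤) (hD : hsSq D ≠ ⊤) :
    hsSq C ^ (1 / 2 : ℝ) * hsSq D ^ (1 / 2 : ℝ) ≠ ⊤ :=
  ENNReal.mul_ne_top (ENNReal.rpow_ne_top_of_nonneg (by norm_num) hC)
    (ENNReal.rpow_ne_top_of_nonneg (by norm_num) hD)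

theorem summable_hsInner {C D : H →L[ℂ] H} (hC : hsSq C ≠ ⊤) (hD : hsSq D ≠ ⊤) :
    Summable fun i => ⟪C (stdBasis H i), D (stdBasis H i)⟫_ℂ := by
  have h := ne_top_of_le_ne_top (sqrt_hsSq_mul_ne_top hC hD) (tsum_enorm_inner_le C D)
  refine Summable.of_norm ((ENNReal.summable_toReal h).congr fun i => ?_)
  rw [toReal_enorm]

theorem enorm_hsInner_le {C D : H →L[ℂ] H} :
    ‖hsInner C D‖ₑ ≤ hsSq C ^ (1 / 2 : ℝ) * hsSq D ^ (1 / 2 : ℝ) :=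
  (enorm_tsum_le_tsum_enorm).trans (tsum_enorm_inner_le C D)

theorem hsInner_sub_hsInner {C D C' D' : H →L[ℂ] H} (hC : hsSq C ≠ ⊤) (hD : hsSq D ≠ ⊤)
    (hC' : hsSq C' ≠ ⊤) (hD' : hsSq D' ≠ ⊤) :
    hsInner C' D' - hsInner C D = hsInner (C' - C) D' + hsInner C (D' - D) := by
  have h1 : hsSq (C' - C) ≠ ⊤ := ne_top_of_le_ne_top (by finiteness) (hsSq_sub_le C' C)
  have h2 : hsSq (D' - D) ≠ ⊤ := ne_top_of_le_ne_top (by finiteness) (hsSq_sub_le D' D)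
  rw [hsInner, hsInner, hsInner, hsInner,
    ← (summable_hsInner hC' hD').tsum_sub (summable_hsInner hC hD),
    ← (summable_hsInner h1 hD').tsum_add (summable_hsInner hC h2)]
  refine tsum_congr fun i => ?_
  simp only [_root_.sub_apply, inner_sub_left, inner_sub_right]
  ring

/-- Convergence in the Hilbert-Schmidt norm. -/
def HSTendsto {α : Type*} (f : α → H →L[ℂ] H) (l : Filter α) (A : H →L[ℂ] H) : Prop :=
  Tendsto (fun x => hsSq (f x - A)) l (𝓝 0)

namespace HSTendsto

variable {α : Type*} {f g : α → H →L[ℂ] H} {l : Filter α} {A B : H →L[ℂ] H}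

theorem of_le {u : α → ℝ≥0∞} (h : ∀ x, hsSq (f x - A) ≤ u x) (hu : Tendsto u l (𝓝 0)) :
    HSTendsto f l A :=
  tendsto_of_tendsto_of_tendsto_of_le_of_le tendsto_const_nhds hu (fun _ => zero_le) h

protected theorem adjoint (h : HSTendsto f l A) :
    HSTendsto (fun x => adjoint (f x)) l (adjoint A) := by
  refine h.congr fun x => ?_
  rw [← map_sub, hsSq_adjoint]

theorem eventually_ne_top (h : HSTendsto f l A) (hA : hsSq A ≠ ⊤) :
    ∀ᶠ x in l, hsSq (f x) ≠ ⊤ := by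
  filter_upwards [h.eventually (gt_mem_nhds one_pos)] with x hx
  have := hsSq_add_le (f x - A) A
  rw [sub_add_cancel] at this
  exact ne_top_of_le_ne_top (by finiteness) this

theorem tendsto (h : HSTendsto f l A) : Tendsto f l (𝓝 A) := by
  rw [tendsto_iff_edist_tendsto_0]
  have h1 : Tendsto (fun x => hsSq (f x - A) ^ (1 / 2 : ℝ)) l (𝓝 0) := by
    have := h.ennrpow_const (1 / 2 : ℝ)
    simpa using this
  refine tendsto_of_tendsto_of_tendsto_of_le_of_le tendsto_const_nhds h1 (fun _ => zero_le)
    fun x => ?_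
  have h2 := ENNReal.rpow_le_rpow (enorm_sq_le_hsSq (f x - A)) (z := 1 / 2) (by norm_num)
  rw [← ENNReal.rpow_two, ← ENNReal.rpow_mul] at h2
  simpa [edist_eq_enorm_sub] using h2

/-- The second factor need only converge in operator norm, since Hilbert-Schmidt operators form an
ideal. -/
theorem mul (hf : HSTendsto f l A) (hA : hsSq A ≠ ⊤) (hg : Tendsto g l (𝓝 B)) :
    HSTendsto (fun x => f x * g x) l (A * B) := by
  refine of_le (u := fun x => 2 * (‖g x‖ₑ ^ 2 * hsSq (f x - A) + ‖g x - B‖ₑ ^ 2 * hsSq A))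
    (fun x => ?_) ?_
  · have : f x * g x - A * B = (f x - A) * g x + A * (g x - B) := by noncomm_ring
    rw [this]
    refine (hsSq_add_le _ _).trans ?_
    gcongr
    · exact hsSq_mul_le' _ _
    · exact hsSq_mul_le' _ _
  · have h1 : Tendsto (fun x => ‖g x‖ₑ ^ 2 * hsSq (f x - A)) l (𝓝 (‖B‖ₑ ^ 2 * 0)) :=
      ENNReal.Tendsto.mul (ENNReal.Tendsto.pow (n := 2) hg.enorm) (Or.inr (by finiteness)) hf
          (Or.inr (by finiteness))
    have h2 : Tendsto (fun x => ‖g x - B‖ₑ ^ 2 * hsSq A) l (𝓝 (0 ^ 2 * hsSq A)) := by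
      have h3 : Tendsto (fun x => ‖g x - B‖ₑ) l (𝓝 0) := by
        have := (tendsto_iff_edist_tendsto_0.mp hg)
        simpa [edist_eq_enorm_sub] using this
      exact ENNReal.Tendsto.mul_const (ENNReal.Tendsto.pow (n := 2) h3) (Or.inr hA)
    have := ENNReal.Tendsto.const_mul (a := 2) (h1.add h2) (Or.inr (by simp))
    simpa using this

theorem hsInner (hf : HSTendsto f l A) (hA : hsSq A ≠ ⊤) (hg : HSTendsto g l B)
    (hB : hsSq B ≠ ⊤) : Tendsto (fun x => hsInner (f x) (g x)) l (𝓝 (hsInner A B)) := by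
  rw [tendsto_iff_edist_tendsto_0]
  have hf' : Tendsto (fun x => hsSq (f x - A) ^ (1 / 2 : ℝ)) l (𝓝 0) := by
    simpa using Tendsto.ennrpow_const (1 / 2 : ℝ) hf
  have hg' : Tendsto (fun x => hsSq (g x - B) ^ (1 / 2 : ℝ)) l (𝓝 0) := by
    simpa using Tendsto.ennrpow_const (1 / 2 : ℝ) hg
  -- `K` bounds the Hilbert-Schmidt norm of `g x` as soon as `hsSq (g x - B) < 1`.
  set K : ℝ≥0∞ := (2 * (1 + hsSq B)) ^ (1 / 2 : ℝ) with hK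
  have hKt : K ≠ ⊤ := ENNReal.rpow_ne_top_of_nonneg (by norm_num) (by finiteness)
  have hAt : hsSq A ^ (1 / 2 : ℝ) ≠ ⊤ := ENNReal.rpow_ne_top_of_nonneg (by norm_num) hA
  have h1 : Tendsto (fun x => hsSq (f x - A) ^ (1 / 2 : ℝ) * K +
      hsSq A ^ (1 / 2 : ℝ) * hsSq (g x - B) ^ (1 / 2 : ℝ)) l (𝓝 0) := by
    have := (ENNReal.Tendsto.mul_const hf' (Or.inr hKt)).add
      (ENNReal.Tendsto.const_mul hg' (Or.inr hAt))
    simpa using this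
  refine tendsto_of_tendsto_of_tendsto_of_le_of_le' tendsto_const_nhds h1
    (Eventually.of_forall fun _ => zero_le) ?_
  filter_upwards [hf.eventually_ne_top hA, hg.eventually_ne_top hB,
    hg.eventually (gt_mem_nhds one_pos)] with x hx hy hz
  rw [edist_eq_enorm_sub, hsInner_sub_hsInner hA hB hx hy]
  refine (enorm_add_le _ _).trans (add_le_add (enorm_hsInner_le.trans ?_) enorm_hsInner_le)
  gcongr
  rw [hK]
  gcongr
  have := hsSq_add_le (g x - B) B
  rw [sub_add_cancel] at this
  refine this.trans ?_
  gcongr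

end HSTendsto

end HilbertSchmidt

/-! ### Trace-class operators as products of two Hilbert-Schmidt operators. -/

section TraceClass

open scoped InnerProductSpace ENNReal Topology
open Filter ContinuousLinearMap

variable {H : Type*} [NormedAddCommGroup H] [InnerProductSpace ℂ H] [CompleteSpace H]

theorem adjoint_mul (A B : H →L[ℂ] H) : adjoint (A * B) = adjoint B * adjoint A :=
  adjoint_comp A B

theorem inner_mul_apply_self {S : H →L[ℂ] H} (hS : IsSelfAdjoint S) (x y : H) :
    ⟪x, (S * S) y⟫_ℂ = ⟪S x, S y⟫_ℂ := by
  have h : adjoint S = S := hS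
  change ⟪x, S (S y)⟫_ℂ = _
  rw [← adjoint_inner_left, h]

/-- The polar decomposition of a bounded operator. -/
theorem exists_polar_decomposition (B : H →L[ℂ] H) :
    ∃ U : H →L[ℂ] H, ‖U‖ ≤ 1 ∧ U * CFC.abs B = B ∧ adjoint U * B = CFC.abs B := by
  set T := CFC.abs B with hT
  have hTs : IsSelfAdjoint T := (CFC.abs_nonneg B).isSelfAdjoint
  have hin : ∀ x y, ⟪T x, T y⟫_ℂ = ⟪B x, B y⟫_ℂ := by
    intro x y
    rw [← inner_mul_apply_self hTs, hT, CFC.abs_mul_abs]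
    change ⟪x, adjoint B (B y)⟫_ℂ = _
    rw [adjoint_inner_right]
  have hno : ∀ x, ‖B x‖ = ‖T x‖ := by
    intro x
    have h := hin x x
    rw [inner_self_eq_norm_sq_to_K, inner_self_eq_norm_sq_to_K] at h
    have h' : ‖T x‖ ^ 2 = ‖B x‖ ^ 2 := by exact_mod_cast h
    exact (sq_eq_sq₀ (norm_nonneg _) (norm_nonneg _)).mp h'.symm
  -- Since `‖B x‖ = ‖T x‖`, the rule `T x ↦ B x` extends to an isometry on the closed range of `T`;
  -- `U` is this map after the orthogonal projection.
  let K : Submodule ℂ H := (LinearMap.range (T : H →ₗ[ℂ] H)).topologicalClosure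
  have hTK : ∀ x, T x ∈ K := fun x => Submodule.le_topologicalClosure _ ⟨x, rfl⟩
  have : CompleteSpace K := (Submodule.isClosed_topologicalClosure _).completeSpace_coe
  let e : H →ₗ[ℂ] K := (T : H →ₗ[ℂ] H).codRestrict K hTK
  have he : DenseRange e := by
    intro y
    rw [closure_subtype]
    have hy : (y : H) ∈ closure (Set.range T) := y.2
    convert hy using 2
    ext z
    constructor
    · rintro ⟨_, ⟨x, rfl⟩, rfl⟩
      exact ⟨x, rfl⟩
    · rintro ⟨x, rfl⟩
      exact ⟨e x, ⟨x, rfl⟩, rfl⟩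
  have hb : ∀ x, ‖(B : H →ₗ[ℂ] H) x‖ ≤ 1 * ‖e x‖ := fun x => by
    rw [one_mul]
    exact (hno x).le
  let V : K →L[ℂ] H := (B : H →ₗ[ℂ] H).extendOfNorm e
  have hV : ∀ x, V (e x) = B x := LinearMap.extendOfNorm_eq he ⟨1, hb⟩
  have hVn : ‖V‖ ≤ 1 := LinearMap.opNorm_extendOfNorm_le he zero_le_one hb
  let U : H →L[ℂ] H := V.comp K.orthogonalProjectionOnto
  have hUT : ∀ x, U (T x) = B x := by
    intro x
    rw [← hV]
    change V (K.orthogonalProjectionOnto (T x)) = _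
    rw [show T x = ((e x : K) : H) from rfl,
        Submodule.orthogonalProjectionOnto_mem_subspace_eq_self]
  refine ⟨U, ?_, ?_, ?_⟩
  · refine (opNorm_comp_le _ _).trans ?_
    exact mul_le_one₀ hVn (norm_nonneg _) K.orthogonalProjectionOnto_norm_le
  · ext x
    exact hUT x
  · ext x
    refine ext_inner_right ℂ fun y => ?_
    change ⟪adjoint U (B x), y⟫_ℂ = _
    rw [adjoint_inner_left]
    have h1 : ∀ z : K, ⟪B x, V z⟫_ℂ = ⟪T x, (z : H)⟫_ℂ := by
      intro z
      refine he.induction_on (p := fun z : K => ⟪B x, V z⟫_ℂ = ⟪T x, (z : H)⟫_ℂ) z ?_ ?_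
      · exact isClosed_eq (by fun_prop) (by fun_prop)
      · intro w
        rw [hV]
        exact (hin x w).symm
    change ⟪B x, V (K.orthogonalProjectionOnto y)⟫_ℂ = _
    rw [h1]
    exact Submodule.inner_orthogonalProjectionOnto_eq_of_mem_left (⟨T x, hTK x⟩ : K) y

/-- From `A = U |A|` and `S = |A|^{1/2}` one gets `A = (S U*)* S`, and `hsSq S = Tr |A|`. The later
facts on trace-class operators rest on this factorization. -/
theorem IsTraceClass.exists_eq_adjoint_mul {A : H →L[ℂ] H} (hA : IsTraceClass A) :
    ∃ C D : H →L[ℂ] H, A = adjoint C * D ∧ hsSq C ≤ ENNReal.ofReal (traceNorm A) ∧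
      hsSq D ≤ ENNReal.ofReal (traceNorm A) := by
  obtain ⟨U, hU, hUA, -⟩ := exists_polar_decomposition A
  set S := CFC.sqrt (CFC.abs A) with hS
  have hSs : IsSelfAdjoint S := (CFC.sqrt_nonneg _).isSelfAdjoint
  have hSS : S * S = CFC.abs A := CFC.sqrt_mul_sqrt_self _ (CFC.abs_nonneg A)
  have hterm : ∀ i, (⟪stdBasis H i, CFC.abs A (stdBasis H i)⟫_ℂ).re = ‖S (stdBasis H i)‖ ^ 2 := by
    intro i
    rw [← hSS, inner_mul_apply_self hSs, inner_self_eq_norm_sq_to_K]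
    norm_cast
  have hsS : hsSq S = ENNReal.ofReal (traceNorm A) := by
    have hA' : Summable fun i => ‖S (stdBasis H i)‖ ^ 2 := by
      simpa only [IsTraceClass, hterm] using hA
    simp only [traceNorm, hterm]
    rw [ENNReal.ofReal_tsum_of_nonneg (fun _ => by positivity) hA', hsSq]
    simp only [enorm_sq_eq_ofReal]
  refine ⟨S * adjoint U, S, ?_, ?_, hsS.le⟩
  · have h : adjoint S = S := hSs
    rw [adjoint_mul, adjoint_adjoint, h, mul_assoc, hSS, hUA]
  · refine (hsSq_mul_le' _ _).trans ?_
    rw [← hsS, enorm_adjoint]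
    have : ‖U‖ₑ ≤ 1 := by
      rw [← ofReal_norm, ← ENNReal.ofReal_one]
      exact ENNReal.ofReal_le_ofReal hU
    calc ‖U‖ₑ ^ 2 * hsSq S ≤ 1 ^ 2 * hsSq S := by gcongr
      _ = hsSq S := by simp

/-- As `|A - B| = U* (A - B)`, its diagonal entries are a difference of two summable series of
Hilbert-Schmidt inner products; no operator inequality for absolute values is needed. -/
theorem isTraceClass_sub_of_eq_adjoint_mul {A B C D C' D' : H →L[ℂ] H} (hA : A = adjoint C * D)
    (hB : B = adjoint C' * D') (hC : hsSq C ≠ ⊤) (hD : hsSq D ≠ ⊤) (hC' : hsSq C' ≠ ⊤)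
    (hD' : hsSq D' ≠ ⊤) : IsTraceClass (A - B) := by
  obtain ⟨U, -, -, hU⟩ := exists_polar_decomposition (A - B)
  have key : ∀ i, ⟪stdBasis H i, CFC.abs (A - B) (stdBasis H i)⟫_ℂ =
      ⟪(C * U) (stdBasis H i), D (stdBasis H i)⟫_ℂ -
        ⟪(C' * U) (stdBasis H i), D' (stdBasis H i)⟫_ℂ := by
    intro i
    rw [← hU, hA, hB]
    change ⟪_, adjoint U (adjoint C (D _) - adjoint C' (D' _))⟫_ℂ = ⟪C (U _), _⟫_ℂ - ⟪C' (U _), _⟫_ℂ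
    rw [adjoint_inner_right, inner_sub_right, adjoint_inner_right, adjoint_inner_right]
  have h1 : hsSq (C * U) ≠ ⊤ := ne_top_of_le_ne_top (by finiteness) (hsSq_mul_le' C U)
  have h2 : hsSq (C' * U) ≠ ⊤ := ne_top_of_le_ne_top (by finiteness) (hsSq_mul_le' C' U)
  have h3 := (summable_hsInner h1 hD).sub (summable_hsInner h2 hD')
  simp only [← key] at h3
  exact Complex.reCLM.summable h3

theorem IsTraceClass.sub {A B : H →L[ℂ] H} (hA : IsTraceClass A) (hB : IsTraceClass B) :
    IsTraceClass (A - B) := by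
  obtain ⟨C, D, h, hC, hD⟩ := hA.exists_eq_adjoint_mul
  obtain ⟨C', D', h', hC', hD'⟩ := hB.exists_eq_adjoint_mul
  exact isTraceClass_sub_of_eq_adjoint_mul h h' (ne_top_of_le_ne_top (by finiteness) hC)
    (ne_top_of_le_ne_top (by finiteness) hD) (ne_top_of_le_ne_top (by finiteness) hC')
    (ne_top_of_le_ne_top (by finiteness) hD')

theorem IsTraceClass.hsSq_le {A : H →L[ℂ] H} (hA : IsTraceClass A) :
    hsSq A ≤ ENNReal.ofReal (traceNorm A) ^ 2 := by
  obtain ⟨C, D, h, hC, hD⟩ := hA.exists_eq_adjoint_mul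
  calc hsSq A ≤ ‖adjoint C‖ₑ ^ 2 * hsSq D := by rw [h]; exact hsSq_mul_le _ _
    _ ≤ hsSq C * hsSq D := by
      gcongr
      rw [enorm_adjoint]
      exact enorm_sq_le_hsSq C
    _ ≤ _ := by rw [sq]; gcongr

theorem IsTraceClass.hsSq_ne_top {A : H →L[ℂ] H} (hA : IsTraceClass A) : hsSq A ≠ ⊤ :=
  ne_top_of_le_ne_top (by finiteness) hA.hsSq_le

theorem IsTraceClass.enorm_trace_le {A : H →L[ℂ] H} (hA : IsTraceClass A) :
    ‖trace A‖ₑ ≤ ENNReal.ofReal (traceNorm A) := by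
  obtain ⟨C, D, h, hC, hD⟩ := hA.exists_eq_adjoint_mul
  rw [h, trace_adjoint_mul, ← h]
  refine enorm_hsInner_le.trans ?_
  calc hsSq C ^ (1 / 2 : ℝ) * hsSq D ^ (1 / 2 : ℝ)
      ≤ ENNReal.ofReal (traceNorm A) ^ (1 / 2 : ℝ) * ENNReal.ofReal (traceNorm A) ^ (1 / 2 : ℝ) :=
          by
        gcongr
    _ = _ := by
      rw [← ENNReal.rpow_add_of_nonneg _ _ (by norm_num) (by norm_num)]
      norm_num

theorem IsTraceClass.summable_trace {A : H →L[ℂ] H} (hA : IsTraceClass A) :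
    Summable fun i => ⟪stdBasis H i, A (stdBasis H i)⟫_ℂ := by
  obtain ⟨C, D, h, hC, hD⟩ := hA.exists_eq_adjoint_mul
  refine (summable_hsInner (ne_top_of_le_ne_top (by finiteness) hC)
    (ne_top_of_le_ne_top (by finiteness) hD)).congr fun i => ?_
  rw [h]
  exact (adjoint_inner_right C _ _).symm

theorem IsTraceClass.trace_sub {A B : H →L[ℂ] H} (hA : IsTraceClass A) (hB : IsTraceClass B) :
    trace (A - B) = trace A - trace B := by
  rw [trace, trace, trace, ← hA.summable_trace.tsum_sub hB.summable_trace]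
  simp only [_root_.sub_apply, inner_sub_right]

/-- Cyclicity of the trace. -/
theorem hsInner_adjoint {C D : H →L[ℂ] H} (hC : hsSq C ≠ ⊤) (hD : hsSq D ≠ ⊤) :
    hsInner (adjoint D) (adjoint C) = hsInner C D := by
  have h1 : ∀ i, ⟪C (stdBasis H i), D (stdBasis H i)⟫_ℂ =
      ∑' j, ⟪C (stdBasis H i), stdBasis H j⟫_ℂ * ⟪stdBasis H j, D (stdBasis H i)⟫_ℂ := fun i =>
    ((stdBasis H).tsum_inner_mul_inner _ _).symm
  have h2 : ∀ j, ⟪adjoint D (stdBasis H j), adjoint C (stdBasis H j)⟫_ℂ =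
      ∑' i, ⟪C (stdBasis H i), stdBasis H j⟫_ℂ * ⟪stdBasis H j, D (stdBasis H i)⟫_ℂ := fun j => by
    rw [← (stdBasis H).tsum_inner_mul_inner]
    refine tsum_congr fun i => ?_
    rw [adjoint_inner_left, adjoint_inner_right, mul_comm]
  rw [hsInner, hsInner]
  simp only [h1, h2]
  refine Summable.tsum_comm ?_
  have h3 : ∑' p : basisIndex H × basisIndex H, ‖⟪C (stdBasis H p.1), stdBasis H p.2⟫_ℂ *
      ⟪stdBasis H p.2, D (stdBasis H p.1)⟫_ℂ‖ₑ ≠ ⊤ := by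
    have h4 : ∀ X : H →L[ℂ] H, ∑' p : basisIndex H × basisIndex H,
        ‖⟪stdBasis H p.2, X (stdBasis H p.1)⟫_ℂ‖ₑ ^ 2 = hsSq X := fun X => by
      rw [ENNReal.tsum_prod' (f := fun p : basisIndex H × basisIndex H =>
        ‖⟪stdBasis H p.2, X (stdBasis H p.1)⟫_ℂ‖ₑ ^ 2)]
      simp only [tsum_enorm_inner_stdBasis_sq]
      rfl
    have h5 : ∀ p : basisIndex H × basisIndex H, ‖⟪C (stdBasis H p.1), stdBasis H p.2⟫_ℂ‖ₑ =
        ‖⟪stdBasis H p.2, C (stdBasis H p.1)⟫_ℂ‖ₑ := fun p => by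
      rw [← ofReal_norm, ← ofReal_norm, norm_inner_symm]
    simp only [enorm_mul, h5]
    refine ne_top_of_le_ne_top ?_ (tsum_mul_le_sqrt_mul_sqrt _ _)
    rw [h4, h4]
    exact sqrt_hsSq_mul_ne_top hC hD
  refine Summable.of_norm ((ENNReal.summable_toReal h3).congr fun p => ?_)
  rw [toReal_enorm]
  rfl

theorem evenPart_sub {E : Type*} [NormedAddCommGroup E] [InnerProductSpace ℂ E] (H₁ : Submodule ℂ E)
    [H₁.HasOrthogonalProjection] (A B : E →L[ℂ] E) : evenPart H₁ (A - B) = evenPart H₁ A - evenPart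
        H₁ B := by
  simp only [evenPart]
  noncomm_ring

theorem oddPart_sub {E : Type*} [NormedAddCommGroup E] [InnerProductSpace ℂ E] (H₁ : Submodule ℂ E)
    [H₁.HasOrthogonalProjection] (A B : E →L[ℂ] E) : oddPart H₁ (A - B) = oddPart H₁ A - oddPart H₁
        B := by
  simp only [oddPart]
  noncomm_ring

theorem evenPart_add_oddPart {E : Type*} [NormedAddCommGroup E] [InnerProductSpace ℂ E]
    (H₁ : Submodule ℂ E) [H₁.HasOrthogonalProjection] (A : E →L[ℂ] E) : evenPart H₁ A + oddPart H₁
        A = A := by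
  have h : H₁ᗮ.starProjection = 1 - H₁.starProjection := Submodule.starProjection_orthogonal' _
  simp only [oddPart, evenPart, h]
  noncomm_ring

variable (H₁ : Submodule ℂ H) [H₁.HasOrthogonalProjection]

theorem hsSq_ne_top_of_mem_L12 {A : H →L[ℂ] H} (hA : A ∈ L12 H₁) : hsSq A ≠ ⊤ := by
  rw [← evenPart_add_oddPart H₁ A]
  have h1 := hA.1.hsSq_ne_top
  have h2 := isHilbertSchmidt_iff.mp hA.2
  exact ne_top_of_le_ne_top (by finiteness) (hsSq_add_le _ _)

/-- Write `A = C* D`. Cyclicity and `P² = P` turn `Tr (P A P)` into `Tr (D P C*)`, likewise for `Q`,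
and `P + Q = 1`. -/
theorem trace_evenPart {A : H →L[ℂ] H} (hA : IsTraceClass A) : trace (evenPart H₁ A) = trace A := by
  obtain ⟨C, D, h, hC, hD⟩ := hA.exists_eq_adjoint_mul
  replace hC : hsSq C ≠ ⊤ := ne_top_of_le_ne_top (by finiteness) hC
  replace hD : hsSq D ≠ ⊤ := ne_top_of_le_ne_top (by finiteness) hD
  set P := H₁.starProjection with hP
  set Q := H₁ᗮ.starProjection with hQ
  have hPQ : P + Q = 1 := by
    rw [hQ, Submodule.starProjection_orthogonal' H₁]; simp [hP]
  have hPs : adjoint P = P := isSelfAdjoint_starProjection H₁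
  have hQs : adjoint Q = Q := isSelfAdjoint_starProjection H₁ᗮ
  have hPP : P * P = P := (Submodule.isIdempotentElem_starProjection H₁)
  have hQQ : Q * Q = Q := (Submodule.isIdempotentElem_starProjection H₁ᗮ)
  have hX : ∀ Y X : H →L[ℂ] H, hsSq Y ≠ ⊤ → hsSq (Y * X) ≠ ⊤ := fun Y X hY =>
    ne_top_of_le_ne_top (by finiteness) (hsSq_mul_le' Y X)
  have h1 : ∀ X : H →L[ℂ] H, adjoint X = X → X * X = X →
      hsInner (C * X) (D * X) = hsInner (adjoint D) (X * adjoint C) := by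
    intro X hXs hXX
    rw [← hsInner_adjoint (hX C X hC) (hX D X hD), adjoint_mul, adjoint_mul, hXs]
    refine tsum_congr fun i => ?_
    change ⟪X (adjoint D _), X (adjoint C _)⟫_ℂ = ⟪_, X (adjoint C _)⟫_ℂ
    rw [← inner_mul_apply_self hXs, hXX]
  have h2 : trace (evenPart H₁ A) = hsInner (C * P) (D * P) + hsInner (C * Q) (D * Q) := by
    rw [hsInner, hsInner, ← (summable_hsInner (hX C P hC) (hX D P hD)).tsum_add
      (summable_hsInner (hX C Q hC) (hX D Q hD))]
    refine tsum_congr fun i => ?_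
    rw [evenPart, h, ← hP, ← hQ]
    change ⟪_, P (adjoint C (D (P _))) + Q (adjoint C (D (Q _)))⟫_ℂ = _
    rw [inner_add_right, ← adjoint_inner_left P, ← adjoint_inner_left Q, hPs, hQs,
      adjoint_inner_right, adjoint_inner_right]
    rfl
  have hD' : hsSq (adjoint D) ≠ ⊤ := by rwa [hsSq_adjoint]
  have hC' : ∀ X : H →L[ℂ] H, hsSq (X * adjoint C) ≠ ⊤ := fun X =>
    ne_top_of_le_ne_top (by rw [hsSq_adjoint]; finiteness) (hsSq_mul_le X (adjoint C))
  rw [h2, h1 P hPs hPP, h1 Q hQs hQQ, h, trace_adjoint_mul, ← hsInner_adjoint hC hD, hsInner,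
    hsInner, ← (summable_hsInner hD' (hC' P)).tsum_add (summable_hsInner hD' (hC' Q))]
  refine tsum_congr fun i => ?_
  rw [← inner_add_right]
  congr 1
  change P (adjoint C _) + Q (adjoint C _) = _
  rw [← _root_.add_apply, hPQ]
  rfl

end TraceClass

/-! ### Sums of principal minors and their continuity. -/

section Minors

open scoped InnerProductSpace ENNReal Topology
open Filter Matrix

variable {E : Type*} [NormedAddCommGroup E] [InnerProductSpace ℂ E] {ι : Type*} [DecidableEq ι]

/-- The matrix of the inner products `⟪u i, v j⟫`, `i, j ∈ F`. -/
def innerMatrix (u v : ι → E) (F : Finset ι) : Matrix F F ℂ := of fun i j => ⟪u i, v j⟫_ℂ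

theorem norm_det_innerMatrix_le (u v : ι → E) (S : Finset ι) :
    ‖(innerMatrix u v S).det‖ ≤ ∏ i ∈ S, ‖u i‖ * ‖v i‖ := by
  rw [← Finset.prod_coe_sort]
  exact norm_det_inner_le (fun i : S => u i) (fun i : S => v i)

/-- Hadamard dominates the minors by the terms of the expanded product `∏ (1 + ‖u i‖ ‖v i‖)`. -/
theorem summable_det_innerMatrix {u v : ι → E} (h : Summable fun i => ‖u i‖ * ‖v i‖) :
    Summable fun S => (innerMatrix u v S).det :=
  (summable_finsetProd_of_summable_nonneg (fun _ => by positivity) h).of_norm_bounded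
    (norm_det_innerMatrix_le u v)

theorem det_inner_eq_det_innerMatrix {n : Type*} [Fintype n] [DecidableEq n] (u v : ι → E)
    (e : n → ι) (he : Function.Injective e) {S : Finset ι} (hS : ∀ x, x ∈ S ↔ ∃ a, e a = x) :
    (of fun a b => ⟪u (e a), v (e b)⟫_ℂ).det = (innerMatrix u v S).det := by
  let g : n ≃ S := Equiv.ofBijective (fun a => ⟨e a, (hS _).mpr ⟨a, rfl⟩⟩)
    ⟨fun a b h => he (congrArg Subtype.val h), fun x => by
      obtain ⟨a, ha⟩ := (hS _).mp x.2
      exact ⟨a, Subtype.ext ha⟩⟩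
  rw [← det_submatrix_equiv_self g]
  rfl

/-- Expand by multilinearity in the rows; identity rows off `s` leave the principal minor on `s`. -/
theorem det_one_add_eq_sum {n : Type*} [Fintype n] [DecidableEq n] (M : Matrix n n ℂ) :
    (1 + M).det = ∑ s : Finset n, (M.submatrix (Subtype.val : s → n) Subtype.val).det := by
  have h := (detRowAlternating (R := ℂ) (n := n)).map_add_univ (fun i => M i)
    (fun i => (1 : Matrix n n ℂ) i)
  rw [add_comm]
  refine Eq.trans h (Finset.sum_congr rfl fun s _ => ?_)
  rw [← det_piecewise_one_eq_submatrix_det]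
  rfl

theorem sum_powerset_det_innerMatrix (u v : ι → E) (F : Finset ι) :
    ∑ S ∈ F.powerset, (innerMatrix u v S).det = (1 + innerMatrix u v F).det := by
  rw [det_one_add_eq_sum]
  symm
  refine Finset.sum_nbij' (fun s => s.map (Function.Embedding.subtype _))
    (fun S => S.subtype (· ∈ F)) ?_ ?_ ?_ ?_ ?_
  · intro s _
    rw [Finset.mem_powerset]
    intro x hx
    obtain ⟨y, -, rfl⟩ := Finset.mem_map.mp hx
    exact y.2
  · simp
  · intro s _
    ext x
    simp
  · intro S hS
    rw [Finset.mem_powerset] at hS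
    rw [Finset.subtype_map_of_mem fun x hx => hS hx]
  · intro s _
    exact det_inner_eq_det_innerMatrix u v (fun a : s => ((a : F) : ι))
      (Subtype.val_injective.comp Subtype.val_injective) (by simp)

theorem tendsto_det_one_add_innerMatrix {u v : ι → E} (h : Summable fun i => ‖u i‖ * ‖v i‖) :
    Tendsto (fun F => (1 + innerMatrix u v F).det) atTop
      (𝓝 (∑' S, (innerMatrix u v S).det)) := by
  refine ((summable_det_innerMatrix h).hasSum.comp
    Filter.tendsto_finset_powerset_atTop_atTop).congr fun F => ?_
  exact sum_powerset_det_innerMatrix u v F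

theorem norm_det_one_add_innerMatrix_le (u v : ι → E) (F : Finset ι) :
    ‖(1 + innerMatrix u v F).det‖ ≤ Real.exp (∑ i ∈ F, ‖u i‖ * ‖v i‖) := by
  rw [← sum_powerset_det_innerMatrix, Real.exp_sum]
  refine (norm_sum_le _ _).trans ?_
  calc ∑ S ∈ F.powerset, ‖(innerMatrix u v S).det‖ ≤ ∑ S ∈ F.powerset, ∏ i ∈ S, ‖u i‖ * ‖v i‖ :=
        Finset.sum_le_sum fun S _ => norm_det_innerMatrix_le u v S
    _ = ∏ i ∈ F, (1 + ‖u i‖ * ‖v i‖) := (Finset.prod_one_add _).symm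
    _ ≤ _ := Finset.prod_le_prod (fun _ _ => by positivity) fun i _ => by
        rw [add_comm]; exact Real.add_one_le_exp _

/-- Local Lipschitz bound for `det (1 + ⟪u i, v j⟫)` in the Hilbert-Schmidt norms of `u` and `v`,
uniform in the finite index set. -/
theorem norm_det_one_add_innerMatrix_sub_le {u v u' v' : ι → E} {F : Finset ι} {N η : ℝ}
    (hη : 0 < η) (hη1 : η < 1) (hN : ∑ i ∈ F, (‖u i‖ ^ 2 + ‖v i‖ ^ 2) ≤ N)
    (hd : ∑ i ∈ F, (‖u' i - u i‖ ^ 2 + ‖v' i - v i‖ ^ 2) ≤ η) :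
    ‖(1 + innerMatrix u' v' F).det - (1 + innerMatrix u v F).det‖ ≤
      3 * Real.exp (N + 1) * Real.sqrt η := by
  -- The conjugate offsets the conjugate-linearity of the first slot, so `f` is holomorphic.
  set a : ℂ → ι → E := fun z i => u i + (starRingEnd ℂ z) • (u' i - u i) with ha
  set b : ℂ → ι → E := fun z i => v i + z • (v' i - v i) with hb
  set f : ℂ → ℂ := fun z => (1 + innerMatrix (a z) (b z) F).det with hf
  have hf0 : f 0 = (1 + innerMatrix u v F).det := by simp [hf, ha, hb]
  have hf1 : f 1 = (1 + innerMatrix u' v' F).det := by simp [hf, ha, hb]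
  have hdiff : Differentiable ℂ f := by
    have he : ∀ i j : F, Differentiable ℂ fun z =>
        (1 + innerMatrix (a z) (b z) F : Matrix F F ℂ) i j := by
      intro i j
      simp only [Matrix.add_apply, innerMatrix, of_apply, ha, hb, inner_add_left, inner_add_right,
        inner_smul_left, inner_smul_right, RingHomCompTriple.comp_apply, RingHom.id_apply]
      fun_prop
    simp only [hf, det_apply']
    refine Differentiable.fun_sum fun σ _ => ?_
    refine Differentiable.const_mul ?_ _
    exact Differentiable.fun_finsetProd fun i _ => he _ _
  have hsq : 0 < Real.sqrt η := Real.sqrt_pos.mpr hη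
  -- For `‖z‖ < r` the perturbation adds at most `‖z‖² η ≤ 1` to the exponent `N`.
  set r : ℝ := (Real.sqrt η)⁻¹ with hr
  have hr0 : 0 < r := inv_pos.mpr hsq
  have hbound : ∀ z, ‖z‖ < r → ‖f z‖ ≤ Real.exp (N + 1) := by
    intro z hz
    refine (norm_det_one_add_innerMatrix_le _ _ _).trans (Real.exp_le_exp.mpr ?_)
    have h1 : ∀ x y : E, ∀ c : ℂ, ‖c‖ = ‖z‖ →
        ‖x + c • y‖ ^ 2 ≤ 2 * (‖x‖ ^ 2 + ‖z‖ ^ 2 * ‖y‖ ^ 2) := by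
      intro x y c hc
      have := (pow_le_pow_left₀ (norm_nonneg _) (norm_add_le x (c • y)) 2).trans add_sq_le
      rwa [norm_smul, hc, mul_pow] at this
    have h2 : ∀ i ∈ F, ‖a z i‖ * ‖b z i‖ ≤ (‖u i‖ ^ 2 + ‖v i‖ ^ 2) +
        ‖z‖ ^ 2 * (‖u' i - u i‖ ^ 2 + ‖v' i - v i‖ ^ 2) := by
      intro i _
      have h3 := h1 (u i) (u' i - u i) (starRingEnd ℂ z) (RCLike.norm_conj z)
      have h4 := h1 (v i) (v' i - v i) z rfl
      have h5 := two_mul_le_add_sq ‖a z i‖ ‖b z i‖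
      simp only [ha, hb] at h5 ⊢
      linarith
    refine (Finset.sum_le_sum h2).trans ?_
    rw [Finset.sum_add_distrib, ← Finset.mul_sum]
    have h6 : ‖z‖ ^ 2 ≤ η⁻¹ := by
      have := pow_le_pow_left₀ (norm_nonneg z) hz.le 2
      rwa [hr, inv_pow, Real.sq_sqrt hη.le] at this
    have h7 := mul_le_mul h6 hd (Finset.sum_nonneg fun _ _ => by positivity) (by positivity)
    rw [inv_mul_cancel₀ hη.ne'] at h7
    exact add_le_add hN h7
  have hmaps : Set.MapsTo f (Metric.ball 0 r) (Metric.closedBall (f 0) (3 * Real.exp (N + 1))) := by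
    intro z hz
    rw [mem_ball_zero_iff] at hz
    rw [mem_closedBall_iff_norm]
    have h1 := hbound z hz
    have h2 := hbound 0 (by simpa using hr0)
    have h3 := Real.exp_pos (N + 1)
    linarith [norm_sub_le (f z) (f 0)]
  have h1r : (1 : ℂ) ∈ Metric.ball (0 : ℂ) r := by
    rw [mem_ball_zero_iff, norm_one, hr, one_lt_inv₀ hsq]
    simpa using Real.sqrt_lt_sqrt hη.le hη1
  -- The Schwarz lemma on the ball of radius `r` yields the factor `1 / r = √η`.
  have := Complex.dist_le_div_mul_dist_of_mapsTo_ball hdiff.differentiableOn hmaps h1r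
  rw [dist_eq_norm, hf0, hf1, dist_zero_right, norm_one, mul_one, hr, div_inv_eq_mul] at this
  exact this

end Minors

/-! ### The Fredholm determinant as a sum of principal minors. -/

section FredholmDeterminant

open scoped InnerProductSpace ENNReal Topology
open Filter Matrix

variable {H : Type*} [NormedAddCommGroup H] [InnerProductSpace ℂ H] [CompleteSpace H]

theorem traceWedge_eq (n : ℕ) (B : H →L[ℂ] H) :
    traceWedge n B = ∑' i : Fin n ↪o basisIndex H,
      (innerMatrix (stdBasis H) (fun j => B (stdBasis H j)) (Finset.univ.map i.toEmbedding)).det :=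
          by
  refine tsum_congr fun i => ?_
  rw [wedgeInner, exteriorPower.map_apply_ιMulti, exteriorPower.pairingDual_ιMulti_ιMulti,
    ← det_transpose]
  exact det_inner_eq_det_innerMatrix (S := Finset.univ.map i.toEmbedding) (stdBasis H)
    (fun j => B (stdBasis H j)) i i.injective fun x => by simp

/-- Finite subsets are enumerated by order embeddings of the types `Fin n`. -/
def orderEmbEquivFinset (ι : Type*) [LinearOrder ι] : (Σ n : ℕ, Fin n ↪o ι) ≃ Finset ι :=
  Equiv.ofBijective (fun f => Finset.univ.map f.2.toEmbedding) (by
    constructor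
    · rintro ⟨n, f⟩ ⟨m, g⟩ h
      have hc := congrArg Finset.card h
      simp only [Finset.card_map, Finset.card_univ, Fintype.card_fin] at hc
      subst hc
      have hf := Finset.orderEmbOfFin_unique' (s := Finset.univ.map f.toEmbedding) (k := n) (by
          simp)
        (f := f) (fun x => by simp)
      have hg := Finset.orderEmbOfFin_unique' (s := Finset.univ.map f.toEmbedding) (k := n) (by
          simp)
        (f := g) (fun x => by simp only [] at h; rw [h]; simp)
      rw [hf, hg]
    · intro s
      refine ⟨⟨s.card, s.orderEmbOfFin rfl⟩, ?_⟩
      ext x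
      simp)

/-- `Tr (∧ⁿ B)` collects the minors on sets of cardinality `n`; the leading `1` is the empty minor.
-/
theorem fredholmDet_eq_tsum {B : H →L[ℂ] H}
    (h : Summable fun S => (innerMatrix (stdBasis H) (fun j => B (stdBasis H j)) S).det) :
    fredholmDet B = ∑' S, (innerMatrix (stdBasis H) (fun j => B (stdBasis H j)) S).det := by
  have h1 := (orderEmbEquivFinset (basisIndex H)).summable_iff.mpr h
  have h2 : ∀ n, traceWedge n B = ∑' f : Fin n ↪o basisIndex H,
      ((fun S => (innerMatrix (stdBasis H) (fun j => B (stdBasis H j)) S).det) ∘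
        orderEmbEquivFinset (basisIndex H)) ⟨n, f⟩ := fun n => traceWedge_eq n B
  have h3 : Summable fun n => traceWedge n B := by
    simp only [h2]
    exact h1.sigma
  rw [← (orderEmbEquivFinset (basisIndex H)).tsum_eq]
  refine Eq.trans ?_ (h1.tsum_sigma).symm
  simp only [← h2]
  rw [h3.tsum_eq_zero_add, fredholmDet, traceWedge_eq]
  congr 1
  let f₀ : Fin 0 ↪o basisIndex H := ⟨⟨Fin.elim0, fun a => a.elim0⟩, fun {a} => a.elim0⟩
  have h0 : ∀ f : Fin 0 ↪o basisIndex H, f = f₀ := fun f => by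
    ext a
    exact a.elim0
  rw [tsum_eq_single f₀ fun f hf => absurd (h0 f) hf, Finset.univ_eq_empty, Finset.map_empty,
    det_isEmpty]

theorem summable_norm_mul_norm {C D : H →L[ℂ] H} (hC : hsSq C ≠ ⊤) (hD : hsSq D ≠ ⊤) :
    Summable fun i => ‖C (stdBasis H i)‖ * ‖D (stdBasis H i)‖ := by
  have h : ∑' i, ‖C (stdBasis H i)‖ₑ * ‖D (stdBasis H i)‖ₑ ≠ ⊤ :=
    ne_top_of_le_ne_top (sqrt_hsSq_mul_ne_top hC hD) (tsum_mul_le_sqrt_mul_sqrt _ _)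
  refine (ENNReal.summable_toReal h).congr fun i => ?_
  rw [ENNReal.toReal_mul, toReal_enorm, toReal_enorm]

theorem innerMatrix_adjoint_mul (C D : H →L[ℂ] H) (F : Finset (basisIndex H)) :
    innerMatrix (stdBasis H) (fun j => (ContinuousLinearMap.adjoint C * D) (stdBasis H j)) F =
      innerMatrix (fun j => C (stdBasis H j)) (fun j => D (stdBasis H j)) F := by
  ext i j
  exact ContinuousLinearMap.adjoint_inner_right C _ _

theorem tendsto_fredholmDet {C D : H →L[ℂ] H} (hC : hsSq C ≠ ⊤) (hD : hsSq D ≠ ⊤) :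
    Tendsto (fun F => (1 + innerMatrix (fun j => C (stdBasis H j))
      (fun j => D (stdBasis H j)) F).det) atTop
      (𝓝 (fredholmDet (ContinuousLinearMap.adjoint C * D))) := by
  have h := summable_norm_mul_norm hC hD
  rw [fredholmDet_eq_tsum]
  · simp only [innerMatrix_adjoint_mul]
    exact tendsto_det_one_add_innerMatrix h
  · simp only [innerMatrix_adjoint_mul]
    exact summable_det_innerMatrix h

theorem sum_norm_sq_le {C : H →L[ℂ] H} (hC : hsSq C ≠ ⊤) (F : Finset (basisIndex H)) :
    ∑ i ∈ F, ‖C (stdBasis H i)‖ ^ 2 ≤ (hsSq C).toReal := by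
  rw [← ENNReal.ofReal_le_iff_le_toReal hC, ENNReal.ofReal_sum_of_nonneg fun _ _ => by positivity]
  simp only [← enorm_sq_eq_ofReal]
  exact ENNReal.sum_le_tsum F

/-- The Fredholm determinant of `1 + C* D` depends continuously on the Hilbert-Schmidt operators
`C` and `D`. -/
theorem HSTendsto.fredholmDet {α : Type*} {f g : α → H →L[ℂ] H} {l : Filter α} {C D : H →L[ℂ] H}
    (hf : HSTendsto f l C) (hC : hsSq C ≠ ⊤) (hg : HSTendsto g l D) (hD : hsSq D ≠ ⊤) :
    Tendsto (fun x => fredholmDet (ContinuousLinearMap.adjoint (f x) * g x)) l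
      (𝓝 (fredholmDet (ContinuousLinearMap.adjoint C * D))) := by
  set N := (hsSq C).toReal + (hsSq D).toReal with hN
  rw [Metric.tendsto_nhds]
  intro ε hε
  set M := 3 * Real.exp (N + 1) with hM
  have hM0 : 0 < M := by positivity
  obtain ⟨η, hη, hη1, hηε⟩ : ∃ η : ℝ, 0 < η ∧ η < 1 ∧ M * Real.sqrt η < ε := by
    have h1 : Tendsto (fun η => M * Real.sqrt η) (𝓝[>] 0) (𝓝 (M * Real.sqrt 0)) :=
      ((continuous_const.mul Real.continuous_sqrt).tendsto 0).mono_left nhdsWithin_le_nhds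
    rw [Real.sqrt_zero, mul_zero] at h1
    have h2 := h1.eventually (gt_mem_nhds hε)
    have h3 : ∀ᶠ η : ℝ in 𝓝[>] 0, η < 1 :=
      nhdsWithin_le_nhds (gt_mem_nhds one_pos)
    obtain ⟨η, h4, h5, h6⟩ := (h2.and (h3.and self_mem_nhdsWithin)).exists
    exact ⟨η, h6, h5, h4⟩
  have hη2 : (0 : ℝ≥0∞) < ENNReal.ofReal (η / 2) := by simpa using hη
  filter_upwards [hf.eventually_ne_top hC, hg.eventually_ne_top hD, hf.eventually (gt_mem_nhds hη2),
    hg.eventually (gt_mem_nhds hη2)] with x hx hy hx2 hy2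
  refine lt_of_le_of_lt ?_ hηε
  have hlim := ((tendsto_fredholmDet hx hy).sub (tendsto_fredholmDet hC hD)).norm
  rw [dist_eq_norm]
  -- The Lipschitz bound does not depend on `F`, so it survives the limit.
  refine le_of_tendsto hlim (Eventually.of_forall fun F => ?_)
  refine norm_det_one_add_innerMatrix_sub_le hη hη1 ?_ ?_
  · rw [Finset.sum_add_distrib]
    exact add_le_add (sum_norm_sq_le hC F) (sum_norm_sq_le hD F)
  · rw [Finset.sum_add_distrib]
    have h1 := sum_norm_sq_le (C := f x - C) hx2.ne_top F
    have h2 := sum_norm_sq_le (C := g x - D) hy2.ne_top F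
    have h3 := ENNReal.toReal_mono ENNReal.ofReal_ne_top hx2.le
    have h4 := ENNReal.toReal_mono ENNReal.ofReal_ne_top hy2.le
    rw [ENNReal.toReal_ofReal (by positivity)] at h3 h4
    simp only [_root_.sub_apply] at h1 h2
    linarith

end FredholmDeterminant

/-! ### The remainder `(1 + A) e^{-A} - 1` as a multiple of `A²`. -/

section ExpRemainder

open scoped Topology

/-- Integrate the derivative `-s A² e^{-sA}` of `(1 + sA) e^{-sA}` over `[0, 1]`. For
Hilbert-Schmidt `A` the result is a product of two Hilbert-Schmidt operators. -/
theorem exists_one_add_mul_exp_neg_sub_one_eq (𝔸 : Type*) [NormedRing 𝔸] [NormedAlgebra ℂ 𝔸]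
    [CompleteSpace 𝔸] :
    ∃ g : 𝔸 → 𝔸, Continuous g ∧ ∀ A, (1 + A) * NormedSpace.exp (-A) - 1 = A * (A * g A) := by
  let _ : NormedAlgebra ℝ 𝔸 := NormedAlgebra.restrictScalars ℝ ℂ 𝔸
  let _ : NormedAlgebra ℚ 𝔸 := NormedAlgebra.restrictScalars ℚ ℝ 𝔸
  have hc : Continuous fun p : 𝔸 × ℝ => -(p.2 • NormedSpace.exp (p.2 • -p.1)) := by
    have := NormedSpace.exp_continuous (𝔸 := 𝔸)
    fun_prop
  refine ⟨fun A => ∫ s in (0 : ℝ)..1, -(s • NormedSpace.exp (s • -A)), ?_, fun A => ?_⟩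
  · exact intervalIntegral.continuous_parametric_intervalIntegral_of_continuous'
      (f := fun A (s : ℝ) => -(s • NormedSpace.exp (s • -A))) hc 0 1
  · have hcA : Continuous fun s : ℝ => -(s • NormedSpace.exp (s • -A)) :=
      hc.comp (Continuous.prodMk_right A)
    have hd : ∀ s : ℝ, HasDerivAt (fun s : ℝ => (1 + s • A) * NormedSpace.exp (s • -A))
        (A * (A * -(s • NormedSpace.exp (s • -A)))) s := by
      intro s
      have h1 : HasDerivAt (fun s : ℝ => 1 + s • A) A s := by
        simpa using ((hasDerivAt_id s).smul_const A).const_add 1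
      have h2 := hasDerivAt_exp_smul_const' (𝕂 := ℝ) (-A) s
      have h3 := h1.mul h2
      refine h3.congr_deriv ?_
      simp only [add_mul, one_mul, neg_mul, mul_neg, smul_mul_assoc, mul_smul_comm]
      abel
    have h := intervalIntegral.integral_eq_sub_of_hasDerivAt (a := 0) (b := 1) (fun s _ => hd s)
      (Continuous.intervalIntegrable (μ := MeasureTheory.volume)
        (continuous_const.mul (continuous_const.mul hcA)) 0 1)
    have hL := (((ContinuousLinearMap.mul ℝ 𝔸 A).comp
      (ContinuousLinearMap.mul ℝ 𝔸 A))).intervalIntegral_comp_comm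
        (hcA.intervalIntegrable (μ := MeasureTheory.volume) 0 1)
    simp only [ContinuousLinearMap.comp_apply, ContinuousLinearMap.mul_apply'] at hL
    rw [← hL, h]
    simp

end ExpRemainder

/-! ### Finite compressions and the regularized determinant. -/

section Compression

open scoped InnerProductSpace ENNReal Topology
open Filter Matrix ContinuousLinearMap

variable {H : Type*} [NormedAddCommGroup H] [InnerProductSpace ℂ H] [CompleteSpace H]

/-- The orthogonal projection onto the span of finitely many basis vectors. -/
def coordProj (F : Finset (basisIndex H)) : H →L[ℂ] H :=
  ∑ i ∈ F, (innerSL ℂ (stdBasis H i)).smulRight (stdBasis H i)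

theorem coordProj_apply (F : Finset (basisIndex H)) (x : H) :
    coordProj F x = ∑ i ∈ F, ⟪stdBasis H i, x⟫_ℂ • stdBasis H i := by
  simp [coordProj]

theorem coordProj_stdBasis (F : Finset (basisIndex H)) (j : basisIndex H) :
    coordProj F (stdBasis H j) = if j ∈ F then stdBasis H j else 0 := by
  rw [coordProj_apply]
  simp only [orthonormal_iff_ite.mp (stdBasis H).orthonormal, ite_smul, one_smul, zero_smul,
    Finset.sum_ite_eq']

theorem adjoint_coordProj (F : Finset (basisIndex H)) : adjoint (coordProj F) = coordProj F := by
  refine ((eq_adjoint_iff _ _).mpr fun x y => ?_).symm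
  simp only [coordProj_apply, sum_inner, inner_sum, inner_smul_left, inner_smul_right,
    inner_conj_symm]
  exact Finset.sum_congr rfl fun i _ => mul_comm _ _

theorem coordProj_mul_self (F : Finset (basisIndex H)) : coordProj F * coordProj F = coordProj F :=
    by
  ext x
  change coordProj F (coordProj F x) = _
  rw [coordProj_apply F x, map_sum]
  refine Finset.sum_congr rfl fun i hi => ?_
  rw [map_smul, coordProj_stdBasis, if_pos hi]

theorem hsSq_mul_coordProj_le (A : H →L[ℂ] H) (F : Finset (basisIndex H)) :
    hsSq (A * coordProj F) ≤ hsSq A := by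
  refine ENNReal.tsum_le_tsum fun i => ?_
  change ‖A (coordProj F _)‖ₑ ^ 2 ≤ _
  rw [coordProj_stdBasis]
  split_ifs <;> simp

theorem hsSq_coordProj_mul_le (A : H →L[ℂ] H) (F : Finset (basisIndex H)) :
    hsSq (coordProj F * A) ≤ hsSq A := by
  rw [← hsSq_adjoint, adjoint_mul, adjoint_coordProj, ← hsSq_adjoint A]
  exact hsSq_mul_coordProj_le _ _

theorem hsTendsto_mul_coordProj {A : H →L[ℂ] H} (hA : hsSq A ≠ ⊤) :
    HSTendsto (fun F => A * coordProj F) atTop A := by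
  have h := ENNReal.tendsto_tsum_compl_atTop_zero (f := fun i => ‖A (stdBasis H i)‖ₑ ^ 2) hA
  refine HSTendsto.of_le (fun F => ?_) h
  rw [hsSq, ← (tsum_subtype_eq_of_support_subset (s := {i | i ∉ F}) ?_)]
  · refine ENNReal.tsum_le_tsum fun i => ?_
    change ‖A (coordProj F _) - A _‖ₑ ^ 2 ≤ _
    rw [coordProj_stdBasis, if_neg i.2, map_zero, zero_sub, enorm_neg]
  · intro i hi hiF
    apply hi
    change ‖A (coordProj F _) - A _‖ₑ ^ 2 = _
    rw [coordProj_stdBasis, if_pos hiF]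
    simp

/-- The compression of `A` to the span of finitely many basis vectors. -/
def compression (A : H →L[ℂ] H) (F : Finset (basisIndex H)) : H →L[ℂ] H :=
  coordProj F * (A * coordProj F)

/-- `P A P - A = P (A P - A) + (A* P - A*)*`, so one-sided convergence for `A` and for `A*`
suffices. -/
theorem hsTendsto_compression {A : H →L[ℂ] H} (hA : hsSq A ≠ ⊤) :
    HSTendsto (compression A) atTop A := by
  have h1 := hsTendsto_mul_coordProj hA
  have h2 := hsTendsto_mul_coordProj (A := adjoint A) (by rwa [hsSq_adjoint])
  have h3 := ENNReal.Tendsto.const_mul (a := 2) (Tendsto.add h1 h2) (Or.inr (by simp))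
  rw [add_zero, mul_zero] at h3
  refine HSTendsto.of_le (fun F => ?_) h3
  have e : compression A F - A = coordProj F * (A * coordProj F - A) +
      adjoint (adjoint A * coordProj F - adjoint A) := by
    rw [map_sub, adjoint_mul, adjoint_adjoint, adjoint_coordProj, compression]
    noncomm_ring
  rw [e]
  refine (hsSq_add_le _ _).trans ?_
  rw [hsSq_adjoint]
  gcongr
  exact hsSq_coordProj_mul_le _ _

/-- The matrix of the compression of `A`. -/
def compressionMatrix (F : Finset (basisIndex H)) (A : H →L[ℂ] H) : Matrix F F ℂ :=
  innerMatrix (stdBasis H) (fun j => A (stdBasis H j)) F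

theorem compressionMatrix_one (F : Finset (basisIndex H)) :
    compressionMatrix F (1 : H →L[ℂ] H) = 1 := by
  ext i j
  change ⟪stdBasis H i, stdBasis H j⟫_ℂ = _
  rw [orthonormal_iff_ite.mp (stdBasis H).orthonormal, one_apply]
  by_cases h : i = j
  · rw [if_pos h, if_pos (congrArg _ h)]
  · rw [if_neg h, if_neg fun h' => h (Subtype.ext h')]

theorem compressionMatrix_add (F : Finset (basisIndex H)) (A B : H →L[ℂ] H) :
    compressionMatrix F (A + B) = compressionMatrix F A + compressionMatrix F B := by
  ext i j
  exact inner_add_right _ _ _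

theorem compressionMatrix_smul (F : Finset (basisIndex H)) (c : ℂ) (A : H →L[ℂ] H) :
    compressionMatrix F (c • A) = c • compressionMatrix F A := by
  ext i j
  exact inner_smul_right _ _ _

theorem inner_compression (A : H →L[ℂ] H) (F : Finset (basisIndex H)) (i j : basisIndex H) :
    ⟪stdBasis H i, compression A F (stdBasis H j)⟫_ℂ =
      if i ∈ F ∧ j ∈ F then ⟪stdBasis H i, A (stdBasis H j)⟫_ℂ else 0 := by
  change ⟪_, coordProj F (A (coordProj F _))⟫_ℂ = _
  rw [← adjoint_inner_left, adjoint_coordProj, coordProj_stdBasis, coordProj_stdBasis]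
  by_cases hi : i ∈ F <;> by_cases hj : j ∈ F <;> simp [hi, hj]

theorem compressionMatrix_compression (A : H →L[ℂ] H) (F : Finset (basisIndex H)) :
    compressionMatrix F (compression A F) = compressionMatrix F A := by
  ext i j
  refine (inner_compression A F i j).trans ?_
  rw [if_pos ⟨i.2, j.2⟩]
  rfl

/-- The hypothesis truncates the sum over intermediate basis vectors to `F`. -/
theorem compressionMatrix_mul {F : Finset (basisIndex H)} {A : H →L[ℂ] H} (B : H →L[ℂ] H)
    (hA : ∀ i ∈ F, ∀ k, k ∉ F → ⟪stdBasis H i, A (stdBasis H k)⟫_ℂ = 0) :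
    compressionMatrix F (A * B) = compressionMatrix F A * compressionMatrix F B := by
  ext i j
  change ⟪_, A (B _)⟫_ℂ = _
  rw [← adjoint_inner_left, ← (stdBasis H).tsum_inner_mul_inner, mul_apply,
    tsum_eq_sum (s := F) fun k hk => by rw [adjoint_inner_left, hA i i.2 k hk, zero_mul],
    ← Finset.sum_coe_sort]
  refine Finset.sum_congr rfl fun k _ => ?_
  rw [adjoint_inner_left]
  rfl

theorem compressionMatrix_compression_pow (A : H →L[ℂ] H) (F : Finset (basisIndex H)) (n : ℕ) :
    compressionMatrix F (compression A F ^ n) = compressionMatrix F A ^ n := by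
  induction n with
  | zero => exact compressionMatrix_one F
  | succ n ih =>
    rw [pow_succ', compressionMatrix_mul, ih, compressionMatrix_compression, pow_succ']
    intro i _ k hk
    rw [inner_compression, if_neg fun h => hk h.2]

theorem continuous_compressionMatrix (F : Finset (basisIndex H)) :
    Continuous (compressionMatrix (H := H) F) := by
  refine continuous_matrix fun i j => ?_
  change Continuous fun A : H →L[ℂ] H => ⟪stdBasis H i, A (stdBasis H j)⟫_ℂ
  fun_prop

section

attribute [local instance] Matrix.linftyOpNormedRing Matrix.linftyOpNormedAlgebra

theorem compressionMatrix_exp_neg_compression (A : H →L[ℂ] H) (F : Finset (basisIndex H)) :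
    compressionMatrix F (NormedSpace.exp (-compression A F)) =
      NormedSpace.exp (-compressionMatrix F A) := by
  have h1 := NormedSpace.exp_series_hasSum_exp' (𝕂 := ℂ) (-compression A F)
  have h2 := NormedSpace.exp_series_hasSum_exp' (𝕂 := ℂ) (-compressionMatrix F A)
  let φ : (H →L[ℂ] H) →+ Matrix F F ℂ :=
    AddMonoidHom.mk' (compressionMatrix F) (compressionMatrix_add F)
  have h3 := h1.map φ (continuous_compressionMatrix F)
  refine h3.unique (h2.congr_fun fun n => ?_)
  change compressionMatrix F _ = _
  have e : ∀ X : H →L[ℂ] H, (-X) ^ n = ((-1 : ℂ) ^ n) • X ^ n := fun X => by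
    rw [← neg_one_smul ℂ X, smul_pow]
  have e' : (-compressionMatrix F A) ^ n = ((-1 : ℂ) ^ n) • compressionMatrix F A ^ n := by
    rw [← neg_one_smul ℂ (compressionMatrix F A), smul_pow]
  rw [compressionMatrix_smul, e, compressionMatrix_smul, compressionMatrix_compression_pow, e']

end

/-- A minor using an index outside `F` has a zero row. -/
theorem fredholmDet_eq_det_of_coordProj_mul {B : H →L[ℂ] H} {F : Finset (basisIndex H)}
    (hB : coordProj F * B = B) : fredholmDet B = (1 + compressionMatrix F B).det := by
  have h0 : ∀ S, S ∉ F.powerset →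
      (innerMatrix (stdBasis H) (fun j => B (stdBasis H j)) S).det = 0 := by
    intro S hS
    rw [Finset.mem_powerset, Finset.not_subset] at hS
    obtain ⟨i, hi, hiF⟩ := hS
    refine det_eq_zero_of_row_eq_zero ⟨i, hi⟩ fun j => ?_
    change ⟪stdBasis H i, B _⟫_ℂ = 0
    rw [← hB]
    change ⟪stdBasis H i, coordProj F (B _)⟫_ℂ = 0
    rw [← adjoint_inner_left, adjoint_coordProj, coordProj_stdBasis, if_neg hiF, inner_zero_left]
  rw [fredholmDet_eq_tsum (summable_of_ne_finset_zero h0), tsum_eq_sum h0,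
    sum_powerset_det_innerMatrix]
  rfl

/-- The regularized determinant `Det ((1 + A) e^{-A})` of a Hilbert-Schmidt operator. -/
def regDet (A : H →L[ℂ] H) : ℂ := fredholmDet ((1 + A) * NormedSpace.exp (-A) - 1)

theorem regDet_compression (A : H →L[ℂ] H) (F : Finset (basisIndex H)) :
    regDet (compression A F) =
      (1 + compressionMatrix F A).det * Complex.exp (-(compressionMatrix F A).trace) := by
  obtain ⟨g, -, hg⟩ := exists_one_add_mul_exp_neg_sub_one_eq (H →L[ℂ] H)
  -- The remainder has `compression A F` as a left factor, so its range lies in the span of `F`.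
  have h1 : coordProj F * ((1 + compression A F) * NormedSpace.exp (-compression A F) - 1) =
      (1 + compression A F) * NormedSpace.exp (-compression A F) - 1 := by
    rw [hg, ← mul_assoc]
    congr 1
    rw [compression, ← mul_assoc, coordProj_mul_self]
  rw [regDet, fredholmDet_eq_det_of_coordProj_mul h1]
  have h2 : 1 + compressionMatrix F ((1 + compression A F) *
      NormedSpace.exp (-compression A F) - 1) =
      (1 + compressionMatrix F A) * NormedSpace.exp (-compressionMatrix F A) := by
    rw [← compressionMatrix_one F, ← compressionMatrix_add, add_sub_cancel, compressionMatrix_mul,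
      compressionMatrix_add, compressionMatrix_compression, compressionMatrix_exp_neg_compression]
    intro i hi k hk
    change ⟪_, stdBasis H k + compression A F _⟫_ℂ = 0
    rw [inner_add_right, inner_compression, if_neg fun h => hk h.2,
      orthonormal_iff_ite.mp (stdBasis H).orthonormal, if_neg (ne_of_mem_of_not_mem hi hk),
      add_zero]
  rw [h2, det_mul, det_exp, trace_neg]

/-- Read the remainder as `(A*)* (A g(A))`; both factors vary continuously in the Hilbert-Schmidt
norm. -/
theorem HSTendsto.regDet {α : Type*} {f : α → H →L[ℂ] H} {l : Filter α} {A : H →L[ℂ] H}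
    (hf : HSTendsto f l A) (hA : hsSq A ≠ ⊤) :
    Tendsto (fun x => regDet (f x)) l (𝓝 (regDet A)) := by
  obtain ⟨g, hgc, hg⟩ := exists_one_add_mul_exp_neg_sub_one_eq (H →L[ℂ] H)
  have h := hf.adjoint.fredholmDet (by rwa [hsSq_adjoint])
    (hf.mul hA ((hgc.tendsto A).comp hf.tendsto))
    (ne_top_of_le_ne_top (by finiteness) (hsSq_mul_le' A (g A)))
  simp only [adjoint_adjoint, Function.comp_apply] at h
  simpa only [ExtDet.regDet, hg] using h

theorem tendsto_regDet_compression {A : H →L[ℂ] H} (hA : hsSq A ≠ ⊤) :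
    Tendsto (fun F => (1 + compressionMatrix F A).det *
      Complex.exp (-(compressionMatrix F A).trace)) atTop (𝓝 (regDet A)) := by
  simp only [← regDet_compression]
  exact (hsTendsto_compression hA).regDet hA

theorem trace_compression_pow (A : H →L[ℂ] H) (F : Finset (basisIndex H)) {k : ℕ} (hk : k ≠ 0) :
    trace (compression A F ^ k) = (compressionMatrix F A ^ k).trace := by
  obtain ⟨k, rfl⟩ := Nat.exists_eq_succ_of_ne_zero hk
  rw [← compressionMatrix_compression_pow, trace, tsum_eq_sum (s := F), ← Finset.sum_coe_sort]
  · rfl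
  · intro i hi
    rw [pow_succ']
    change ⟪_, compression A F _⟫_ℂ = 0
    change ⟪_, coordProj F _⟫_ℂ = 0
    rw [← adjoint_inner_left, adjoint_coordProj, coordProj_stdBasis, if_neg hi, inner_zero_left]

theorem hsSq_pow_ne_top {A : H →L[ℂ] H} (hA : hsSq A ≠ ⊤) {k : ℕ} (hk : k ≠ 0) :
    hsSq (A ^ k) ≠ ⊤ := by
  obtain ⟨k, rfl⟩ := Nat.exists_eq_succ_of_ne_zero hk
  rw [pow_succ]
  exact ne_top_of_le_ne_top (by finiteness) (hsSq_mul_le _ _)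

/-- For `k ≥ 2` the trace is the Hilbert-Schmidt inner product of `A*` and `A ^ (k - 1)`. -/
theorem tendsto_trace_compression_pow {A : H →L[ℂ] H} (hA : hsSq A ≠ ⊤) {k : ℕ} (hk : 2 ≤ k) :
    Tendsto (fun F => (compressionMatrix F A ^ k).trace) atTop (𝓝 (trace (A ^ k))) := by
  have h1 := hsTendsto_compression hA
  obtain ⟨k, rfl⟩ := Nat.exists_eq_add_of_le' hk
  have h2 : HSTendsto (fun F => compression A F ^ (k + 1)) atTop (A ^ (k + 1)) := by
    simp only [pow_succ']
    exact h1.mul hA (h1.tendsto.pow k)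
  have h3 := h1.adjoint.hsInner (by rwa [hsSq_adjoint]) h2 (hsSq_pow_ne_top hA k.succ_ne_zero)
  simp only [← trace_adjoint_mul, adjoint_adjoint, ← pow_succ'] at h3
  simpa only [trace_compression_pow A _ (k + 1).succ_ne_zero] using h3

theorem sum_norm_sq_compressionMatrix_le {A : H →L[ℂ] H} (hA : hsSq A ≠ ⊤)
    (F : Finset (basisIndex H)) :
    ∑ i, ∑ j, ‖compressionMatrix F A i j‖ ^ 2 ≤ (hsSq A).toReal := by
  refine le_trans ?_ (sum_norm_sq_le hA F)
  rw [Finset.sum_comm, ← Finset.sum_coe_sort F]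
  refine Finset.sum_le_sum fun j _ => ?_
  have := (stdBasis H).orthonormal.sum_inner_products_le (A (stdBasis H j)) (s := F)
  rw [← Finset.sum_coe_sort F] at this
  exact this

end Compression

/-! ### The cycle expansion by dominated convergence. -/

section CycleExpansion

open scoped InnerProductSpace ENNReal Topology
open Filter Matrix ContinuousLinearMap

theorem tendsto_signedCycleIndex {α : Type*} {l : Filter α} {s : α → ℕ → ℂ} {t : ℕ → ℂ}
    (h : ∀ k, 0 < k → Tendsto (fun x => s x k) l (𝓝 (t k))) (n : ℕ) :
    Tendsto (fun x => signedCycleIndex (s x) n) l (𝓝 (signedCycleIndex t n)) :=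
  (tendsto_finsetSum _ fun ξ _ => (tendsto_multiset_prod _ fun _ hi =>
    h _ (ξ.partition.parts_pos hi)).const_mul _).const_mul _

/-- Uniqueness in Newton's recursion makes these the Taylor coefficients of `det (1 + zY) e^{cz}`.
Any radius above `1` would give geometric decay; the radius `2` accounts for the factors `2` and
`4`. -/
theorem norm_signedCycleIndex_le {κ : Type*} [Fintype κ] [DecidableEq κ] (Y : Matrix κ κ ℂ)
    (c : ℂ) {t : ℕ → ℂ} (h1 : t 1 = Y.trace + c) (ht : ∀ k, 2 ≤ k → t k = (Y ^ k).trace) :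
    (∀ n, ‖signedCycleIndex t n‖ ≤
      Real.exp (2 * ‖t 1‖ + 4 * ∑ i, ∑ j, ‖Y i j‖ ^ 2) / 2 ^ n) ∧
    ∑' n, signedCycleIndex t n = (1 + Y).det * Complex.exp c := by
  obtain ⟨a, ha, hs⟩ := exists_isNewtonSeries_hasSum Y c h1 ht
  obtain rfl := (isNewtonSeries_signedCycleIndex t).unique ha
  refine ⟨norm_coeff_le_of_forall_mem_sphere (fun z => (hs z).1) two_pos fun z hz => ?_, ?_⟩
  · rw [mem_sphere_zero_iff_norm] at hz
    rw [(hs z).2]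
    -- As `cz = z t₁ - tr (zY)`, the bound involves `t 1` and the Hilbert-Schmidt norm of `Y`, but
    -- neither `c` nor `tr Y`.
    have h := norm_det_one_add_mul_exp_le (z • Y) (z * t 1)
    have e : z * t 1 - (z • Y).trace = c * z := by
      rw [h1, Matrix.trace_smul, smul_eq_mul]
      ring
    rw [e] at h
    refine h.trans_eq ?_
    rw [norm_mul, hz, Finset.mul_sum]
    simp only [Matrix.smul_apply, smul_eq_mul, norm_mul, hz, mul_pow, Finset.mul_sum]
    norm_num
  · simpa using (hs 1).2

variable {H : Type*} [NormedAddCommGroup H] [InnerProductSpace ℂ H] [CompleteSpace H]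

/-- The cycle expansion of the regularized determinant of a Hilbert-Schmidt operator, for an
arbitrary choice of the trace of its first power. -/
theorem summable_signedCycleIndex_and_tsum_eq {A : H →L[ℂ] H} (hA : hsSq A ≠ ⊤) {t : ℕ → ℂ}
    (ht : ∀ k, 2 ≤ k → t k = trace (A ^ k)) :
    Summable (signedCycleIndex t) ∧
      ∑' n, signedCycleIndex t n = regDet A * Complex.exp (t 1) := by
  -- The first power sum is frozen at `t 1`, as the traces of the compressions need not converge.
  set s : Finset (basisIndex H) → ℕ → ℂ := fun F k =>
    if k = 1 then t 1 else (compressionMatrix F A ^ k).trace with hs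
  have hs1 : ∀ F, s F 1 = t 1 := fun F => if_pos rfl
  have hs2 : ∀ F k, 2 ≤ k → s F k = (compressionMatrix F A ^ k).trace := fun F k hk =>
    if_neg (by omega)
  set M := Real.exp (2 * ‖t 1‖ + 4 * (hsSq A).toReal) with hM
  have hfin := fun F => norm_signedCycleIndex_le (compressionMatrix F A)
    (t 1 - (compressionMatrix F A).trace) (t := s F) (by rw [hs1]; ring) (hs2 F)
  have hb : ∀ F n, ‖signedCycleIndex (s F) n‖ ≤ M / 2 ^ n := fun F n => by
    refine ((hfin F).1 n).trans ?_
    rw [hs1, hM]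
    gcongr
    exact sum_norm_sq_compressionMatrix_le hA F
  have hlim : ∀ n, Tendsto (fun F => signedCycleIndex (s F) n) atTop
      (𝓝 (signedCycleIndex t n)) := by
    refine tendsto_signedCycleIndex fun k hk => ?_
    obtain rfl | hk : k = 1 ∨ 2 ≤ k := by omega
    · simp only [hs1]
      exact tendsto_const_nhds
    · simp only [hs2 _ k hk, ht k hk]
      exact tendsto_trace_compression_pow hA hk
  have hsum : Summable fun n : ℕ => M / 2 ^ n := by
    simpa [div_eq_mul_inv] using summable_geometric_two.mul_left M
  refine ⟨Summable.of_norm_bounded hsum fun n => le_of_tendsto' (hlim n).norm fun F => hb F n, ?_⟩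
  refine tendsto_nhds_unique (tendsto_tsum_of_dominated_convergence hsum hlim
    (Eventually.of_forall hb)) ?_
  have h := (tendsto_regDet_compression hA).mul_const (Complex.exp (t 1))
  refine h.congr fun F => ?_
  rw [(hfin F).2, mul_assoc, ← Complex.exp_add]
  ring_nf

/-- For trace-class `A` both `det (1 + A_F)` and `tr A_F` converge, so the regularizing factor can
be undone in the limit. -/
theorem fredholmDet_eq_regDet_mul_exp {A : H →L[ℂ] H} (hA : IsTraceClass A) :
    fredholmDet A = regDet A * Complex.exp (trace A) := by
  obtain ⟨C, D, h, hC, hD⟩ := hA.exists_eq_adjoint_mul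
  have h1 := tendsto_fredholmDet (ne_top_of_le_ne_top (by finiteness) hC)
    (ne_top_of_le_ne_top (by finiteness) hD)
  simp only [← innerMatrix_adjoint_mul, ← h] at h1
  have h2 : Tendsto (fun F => (compressionMatrix F A).trace) atTop (𝓝 (trace A)) := by
    refine hA.summable_trace.hasSum.congr fun F => ?_
    rw [← Finset.sum_coe_sort]
    rfl
  refine tendsto_nhds_unique h1 (((tendsto_regDet_compression hA.hsSq_ne_top).mul
    ((Complex.continuous_exp.tendsto _).comp h2)).congr fun F => ?_)
  rw [Function.comp_apply, mul_assoc, ← Complex.exp_add, neg_add_cancel, Complex.exp_zero, mul_one]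
  rfl

end CycleExpansion

/-! ### The extended determinant on `L12 H₁`. -/

section ExtendedDeterminant

open scoped InnerProductSpace ENNReal Topology
open Filter ContinuousLinearMap

variable {H : Type*} [NormedAddCommGroup H] [InnerProductSpace ℂ H] [CompleteSpace H]
  (H₁ : Submodule ℂ H) [H₁.HasOrthogonalProjection]

theorem extDet_eq_fredholmDet {A : H →L[ℂ] H} (hA : IsTraceClass A) :
    extDet H₁ A = fredholmDet A := by
  rw [fredholmDet_eq_regDet_mul_exp hA, ← trace_evenPart H₁ hA]
  rfl

theorem summable_cycleCoeff_and_extDet_eq {A : H →L[ℂ] H} (hA : A ∈ L12 H₁) :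
    Summable (fun n => cycleCoeff H₁ (n + 1) A) ∧
      extDet H₁ A = 1 + ∑' n, cycleCoeff H₁ (n + 1) A := by
  obtain ⟨h1, h2⟩ := summable_signedCycleIndex_and_tsum_eq (hsSq_ne_top_of_mem_L12 H₁ hA)
    (t := powTrace H₁ A) fun k hk => if_neg (by omega)
  have hc : ∀ n, cycleCoeff H₁ n A = signedCycleIndex (powTrace H₁ A) n := fun _ => rfl
  simp only [hc]
  refine ⟨(summable_nat_add_iff 1).mpr h1, ?_⟩
  have h4 : extDet H₁ A = regDet A * Complex.exp (powTrace H₁ A 1) := by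
    rw [powTrace, if_pos rfl]
    rfl
  rw [h4, ← h2, h1.tsum_eq_zero_add, (isNewtonSeries_signedCycleIndex _).zero]

variable {α : Type*} {l : Filter α} {A : H →L[ℂ] H} {B : α → H →L[ℂ] H}

theorem hsTendsto_of_tendsto_traceNorm_of_tendsto_hsNorm (hA : A ∈ L12 H₁) (hB : ∀ x, B x ∈ L12 H₁)
    (h1 : Tendsto (fun x => traceNorm (evenPart H₁ (B x - A))) l (𝓝 0))
    (h2 : Tendsto (fun x => hsNorm (oddPart H₁ (B x - A))) l (𝓝 0)) : HSTendsto B l A := by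
  have h3 : Tendsto (fun x => 2 * (ENNReal.ofReal (traceNorm (evenPart H₁ (B x - A))) ^ 2 +
      ENNReal.ofReal (hsNorm (oddPart H₁ (B x - A)) ^ 2))) l (𝓝 0) := by
    have h := ENNReal.Tendsto.const_mul (a := 2) ((ENNReal.Tendsto.pow (n := 2)
      (ENNReal.tendsto_ofReal h1)).add
      (ENNReal.tendsto_ofReal (h2.pow 2))) (Or.inr (by simp))
    simpa using h
  refine HSTendsto.of_le (fun x => ?_) h3
  conv_lhs => rw [← evenPart_add_oddPart H₁ (B x - A)]
  refine (hsSq_add_le _ _).trans ?_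
  have h4 : IsTraceClass (evenPart H₁ (B x - A)) := by
    rw [evenPart_sub]
    exact (hB x).1.sub hA.1
  have h5 : IsHilbertSchmidt (oddPart H₁ (B x - A)) := by
    have h6 := isHilbertSchmidt_iff.mp hA.2
    have h7 := isHilbertSchmidt_iff.mp (hB x).2
    rw [oddPart_sub, isHilbertSchmidt_iff]
    exact ne_top_of_le_ne_top (by finiteness) (hsSq_sub_le _ _)
  rw [hsSq_eq_ofReal_hsNorm h5]
  gcongr
  exact h4.hsSq_le

theorem tendsto_trace_evenPart (hA : A ∈ L12 H₁) (hB : ∀ x, B x ∈ L12 H₁)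
    (h1 : Tendsto (fun x => traceNorm (evenPart H₁ (B x - A))) l (𝓝 0)) :
    Tendsto (fun x => trace (evenPart H₁ (B x))) l (𝓝 (trace (evenPart H₁ A))) := by
  rw [tendsto_iff_edist_tendsto_0]
  have h2 := ENNReal.tendsto_ofReal h1
  rw [ENNReal.ofReal_zero] at h2
  refine tendsto_of_tendsto_of_tendsto_of_le_of_le tendsto_const_nhds h2 (fun _ => zero_le)
    fun x => ?_
  rw [edist_eq_enorm_sub, ← (hB x).1.trace_sub hA.1, evenPart_sub]
  exact ((hB x).1.sub hA.1).enorm_trace_le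

theorem tendsto_extDet (hA : A ∈ L12 H₁) (hB : ∀ x, B x ∈ L12 H₁)
    (h1 : Tendsto (fun x => traceNorm (evenPart H₁ (B x - A))) l (𝓝 0))
    (h2 : Tendsto (fun x => hsNorm (oddPart H₁ (B x - A))) l (𝓝 0)) :
    Tendsto (fun x => extDet H₁ (B x)) l (𝓝 (extDet H₁ A)) :=
  ((hsTendsto_of_tendsto_traceNorm_of_tendsto_hsNorm H₁ hA hB h1 h2).regDet
    (hsSq_ne_top_of_mem_L12 H₁ hA)).mul
    ((Complex.continuous_exp.tendsto _).comp (tendsto_trace_evenPart H₁ hA hB h1))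

theorem traceNorm_nonneg (A : H →L[ℂ] H) : 0 ≤ traceNorm A :=
  tsum_nonneg fun i => by
    have h := (ContinuousLinearMap.nonneg_iff_isPositive _).mp (CFC.abs_nonneg A)
    exact h.re_inner_nonneg_right (stdBasis H i)

theorem isContinuousExtension_extDet : IsContinuousExtension H₁ (extDet H₁) := by
  refine ⟨fun A hA => extDet_eq_fredholmDet H₁ hA, fun A hA ε hε => ?_⟩
  by_contra! h
  -- Failure for every `δ = 1 / (n + 1)` yields a sequence tending to `A` along which the
  -- determinants stay `ε` away.
  choose B hB h1 h2 h3 using fun n : ℕ => h (1 / ((n : ℝ) + 1)) (by positivity)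
  have h4 := tendsto_extDet H₁ hA hB
    (squeeze_zero (fun _ => traceNorm_nonneg _) (fun n => (h1 n).le)
      tendsto_one_div_add_atTop_nhds_zero_nat)
    (squeeze_zero (fun _ => Real.sqrt_nonneg _) (fun n => (h2 n).le)
      tendsto_one_div_add_atTop_nhds_zero_nat)
  obtain ⟨n, hn⟩ := ((Metric.tendsto_nhds.mp h4) ε hε).exists
  rw [dist_eq_norm] at hn
  exact (h3 n).not_gt hn

end ExtendedDeterminant

end ExtDet

end

theorem mainTheorem5 {H : Type*} [NormedAddCommGroup H] [InnerProductSpace ℂ H] [CompleteSpace H]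
    [TopologicalSpace.SeparableSpace H]
    (H₁ : Submodule ℂ H) [H₁.HasOrthogonalProjection] :
    ExtDet.IsContinuousExtension H₁ (ExtDet.extDet H₁) ∧
    ∀ A ∈ ExtDet.L12 H₁,
      Summable (fun n : ℕ => ExtDet.cycleCoeff H₁ (n + 1) A) ∧
      ExtDet.extDet H₁ A = 1 + ∑' n : ℕ, ExtDet.cycleCoeff H₁ (n + 1) A :=
  ⟨ExtDet.isContinuousExtension_extDet H₁, fun _ hA =>
    ExtDet.summable_cycleCoeff_and_extDet_eq H₁ hA⟩
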